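/- Let $K$ be a field extension of $\mathbb C$ and let $\theta\in K$ be either a positive real number or transcendental over $\mathbb C$ (a formal variable). Fix $N\ge 1$. For $1\le i\le N$ the Dunkl operator on $K[x_1,\dots,x_N]$ is $$\mathcal D_i=\frac{\partial}{\partial x_i}+\theta\sum_{j\ne i}\frac{1-(i,j)}{x_i-x_j},$$ where $(i,j)$ permutes the variables $x_i$ and $x_j$, and for $m\ge1$ the Heckman–Polychronakos operator is $\mathcal P_m=\sum_{i=1}^N (x_i\mathcal D_i)^m$. Jack polynomials are defined as follows. Let $\Lambda=K[p_1,p_2,\dots]$ be the ring of symmetric functions, $p_k$ being the power sums, with the bilinear form $\langle p_\mu,p_\nu\rangle=\delta_{\mu\nu}\,\theta^{-\ell(\mu)}\prod_{k\ge1}k^{a_k}a_k!$, where $\mu$ has $\ell(\mu)$ parts in all and $a_k$ parts equal to $k$. Let $m_\mu$ be the monomial symmetric functions and $\preceq$ the dominance order on partitions. For a partition $\lambda$ let $P_\lambda\in\Lambda$ be the symmetric function such that $P_\lambda-m_\lambda$ is a linear combination of the $m_\mu$ with $\mu\prec\lambda$ and $\langle P_\lambda,m_\mu\rangle=0$ for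 all $\mu\prec\lambda$. For $\lambda=(\lambda_1\ge\dots\ge\lambda_N\ge0)$ put $$J_\lambda(x_1,\dots,x_N;\theta)=\prod_{s\in\lambda}\bigl(\theta^{-1}a(s)+l(s)+1\bigr)\cdot P_\lambda(x_1,\dots,x_N,0,0,\dots),$$ where $a(s)$ and $l(s)$ are the arm and leg lengths of the box $s$ of the Young diagram of $\lambda$. For $r\ge1$ and $m\ge0$ let $h^{(r)}_m(x_1,\dots,x_N)$ be the sum of the complete homogeneous symmetric polynomials $h_m(x_{i_1},\dots,x_{i_r})$ over all $r$-element subsets $\{i_1,\dots,i_r\}$ of $\{1,\dots,N\}$, and let $h^{(r)}_m=0$ for $m<0$. **Theorem.** Let $\lambda_1\ge\dots\ge\lambda_N\ge0$ be integers and put $\ell_i=\lambda_i+\theta(N-i)$. Then $P_\lambda$ exists and is unique, $J_\lambda(x_1,\dots,x_N;\theta)\neq0$, and for every $m\ge1$ $$\mathcal P_m J_\lambda(x_1,\dots,x_N;\theta)=\mathrm{eig}_m(\lambda)\,J_\lambda(x_1,\dots,x_N;\theta),\qquad \mathrm{eig}_m(\lambda)=\sum_{r=1}^{N}(-\theta)^{r-1}h^{(r)}_{m+1-r}(\ell_1,\dots,\ell_N).$$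 Moreover $\mathrm{eig}_m(\lambda)=\mathbf 1^{T}U^m\mathbf 1$, where $\mathbf 1=(1,\dots,1)^T$ and $U$ is the upper triangular $N\times N$ matrix with diagonal entries $\ell_1,\dots,\ell_N$ and all entries above the diagonal equal to $-\theta$. -/

import Mathlib

noncomputable section

namespace HeckmanPolychronakos

open MvPolynomial

/-! ### Dunkl and Heckman–Polychronakos operators -/

theorem X_sub_X_dvd {K : Type*} [Field K] {N : ℕ} (i j : Fin N) (f : MvPolynomial (Fin N) K) :
    (X i - X j) ∣ f - rename (Equiv.swap i j) f := by
  have key : (Ideal.Quotient.mkₐ K (Ideal.span {(X i - X j : MvPolynomial (Fin N) K)})) =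
      (Ideal.Quotient.mkₐ K (Ideal.span {(X i - X j : MvPolynomial (Fin N) K)})).comp
        (rename (Equiv.swap i j)) := by
    have hij : Ideal.Quotient.mk (Ideal.span {(X i - X j : MvPolynomial (Fin N) K)}) (X i) =
        Ideal.Quotient.mk _ (X j) :=
      Ideal.Quotient.eq.2 (Ideal.mem_span_singleton_self _)
    apply MvPolynomial.algHom_ext
    intro k
    simp only [AlgHom.comp_apply, rename_X, Ideal.Quotient.mkₐ_eq_mk]
    rcases eq_or_ne k i with rfl | hi
    · rw [Equiv.swap_apply_left, hij]
    · rcases eq_or_ne k j with rfl | hj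
      · rw [Equiv.swap_apply_right, hij]
      · rw [Equiv.swap_apply_of_ne_of_ne hi hj]
  rw [← Ideal.mem_span_singleton, ← Ideal.Quotient.eq]
  exact congrArg (fun φ => φ f) key

theorem X_sub_X_ne_zero {K : Type*} [Field K] {N : ℕ} {i j : Fin N} (h : j ≠ i) :
    (X i - X j : MvPolynomial (Fin N) K) ≠ 0 :=
  sub_ne_zero.2 fun e => h (X_injective e).symm

/-- The operator `(1 - (i,j)) / (x_i - x_j)` on polynomials: the value at `f` is the unique
polynomial `q` with `f - (i,j) f = (x_i - x_j) q`. -/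
def diffQuot (K : Type*) [Field K] {N : ℕ} {i j : Fin N} (h : j ≠ i) :
    MvPolynomial (Fin N) K →ₗ[K] MvPolynomial (Fin N) K where
  toFun f := (X_sub_X_dvd i j f).choose
  map_add' f g := by
    apply mul_left_cancel₀ (X_sub_X_ne_zero (K := K) h)
    rw [mul_add, ← (X_sub_X_dvd i j (f + g)).choose_spec, ← (X_sub_X_dvd i j f).choose_spec,
      ← (X_sub_X_dvd i j g).choose_spec, map_add]
    ring
  map_smul' c f := by
    apply mul_left_cancel₀ (X_sub_X_ne_zero (K := K) h)
    rw [RingHom.id_apply, mul_smul_comm, ← (X_sub_X_dvd i j (c • f)).choose_spec,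
      ← (X_sub_X_dvd i j f).choose_spec, map_smul, smul_sub]

/-- The defining equation of `diffQuot`. -/
theorem mul_diffQuot {K : Type*} [Field K] {N : ℕ} {i j : Fin N} (h : j ≠ i)
    (f : MvPolynomial (Fin N) K) :
    (X i - X j) * diffQuot K h f = f - rename (Equiv.swap i j) f :=
  (X_sub_X_dvd i j f).choose_spec.symm

/-- The Dunkl operator `D_i = ∂/∂x_i + θ ∑_{j ≠ i} (1 - (i,j)) / (x_i - x_j)`. -/
def dunkl {K : Type*} [Field K] {N : ℕ} (θ : K) (i : Fin N) :
    Module.End K (MvPolynomial (Fin N) K) :=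
  (pderiv i).toLinearMap + θ • ∑ j : {j : Fin N // j ≠ i}, diffQuot K j.2

/-- The Heckman–Polychronakos operator `P_m = ∑_i (x_i D_i)^m`. -/
def hpOp {K : Type*} [Field K] (N : ℕ) (θ : K) (m : ℕ) :
    Module.End K (MvPolynomial (Fin N) K) :=
  ∑ i : Fin N, (LinearMap.mulLeft K (X i) * dunkl θ i) ^ m

/-! ### Symmetric functions

Over a field of characteristic zero the ring `Λ` of symmetric functions (in infinitely many
variables) is the polynomial ring in the power sums `p_1, p_2, …`. -/

/-- The ring of symmetric functions; the variable `X k` is the power sum `p_k`. -/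
abbrev SymFn (K : Type*) [Field K] : Type _ := MvPolynomial ℕ+ K

/-- The specialization `F ↦ F(x_1, …, x_N) = F(x_1, …, x_N, 0, 0, …)`. -/
def SymFn.toVars {K : Type*} [Field K] (N : ℕ) : SymFn K →ₐ[K] MvPolynomial (Fin N) K :=
  aeval fun k : ℕ+ => psum (Fin N) K (k : ℕ)

/-- The deformed Hall inner product, with `⟨p_μ, p_ν⟩ = 0` for `μ ≠ ν` and
`⟨p_μ, p_μ⟩ = z_μ α ^ ℓ(μ)`, where `α = 1/θ` and `z_μ = ∏_k k ^ {a_k} a_k !` for `μ` with `a_k`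
parts equal to `k`. -/
def hall {K : Type*} [Field K] (θ : K) (f g : SymFn K) : K :=
  ∑ a ∈ f.support, f.coeff a * g.coeff a *
    a.prod fun (k : ℕ+) (r : ℕ) => (((k : ℕ) : K) / θ) ^ r * (r.factorial : K)

/-! ### Jack polynomials -/

/-- The sum of the `k` largest parts of a partition. -/
def partialSum {n : ℕ} (μ : n.Partition) (k : ℕ) : ℕ :=
  ((μ.parts.sort (· ≥ ·)).take k).sum

/-- The dominance order on partitions of `n`: `μ ⪯ ν`. -/
def DomLE {n : ℕ} (μ ν : n.Partition) : Prop :=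
  ∀ k, partialSum μ k ≤ partialSum ν k

/-- `g` is the monomial symmetric function `m_μ`. -/
def IsMonomialSymm {K : Type*} [Field K] {n : ℕ} (μ : n.Partition) (g : SymFn K) : Prop :=
  ∀ N : ℕ, SymFn.toVars N g = msymm (Fin N) K μ

/-- `f` is the monic Jack symmetric function `P_ν` with parameter `θ = 1/α`:
`f` is `m_ν` plus a linear combination of the `m_μ` with `μ ≺ ν`, and it is orthogonal to all
these `m_μ`. -/
structure IsJackP {K : Type*} [Field K] (θ : K) {n : ℕ} (ν : n.Partition) (f : SymFn K) :
    Prop where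
  triangular : ∃ u : n.Partition → K, u ν = 1 ∧ (∀ μ, u μ ≠ 0 → DomLE μ ν) ∧
    ∀ N : ℕ, SymFn.toVars N f = ∑ μ, u μ • msymm (Fin N) K μ
  orthogonal : ∀ μ : n.Partition, DomLE μ ν → μ ≠ ν →
    ∀ g : SymFn K, IsMonomialSymm μ g → hall θ f g = 0

/-- The monic Jack symmetric function `P_ν`, the one with `IsJackP θ ν`. -/
def jackP {K : Type*} [Field K] (θ : K) {n : ℕ} (ν : n.Partition) : SymFn K :=
  Classical.epsilon (IsJackP θ ν)

/-- The partition with the parts `lam 0, …, lam (N - 1)` (zeros are dropped). -/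
def toPartition {N : ℕ} (lam : Fin N → ℕ) : (∑ i, lam i).Partition :=
  Nat.Partition.ofSums _ (Finset.univ.val.map lam) rfl

/-- The factor `c_λ = ∏_{s ∈ λ} (α a(s) + l(s) + 1)` with `α = 1/θ`. The box `s` in row `i` and
column `j` (both counted from 0) has arm length `λ_i - j - 1`, and its leg length is the number of
rows below row `i` with more than `j` boxes. -/
def jackFactor {K : Type*} [Field K] (θ : K) {N : ℕ} (lam : Fin N → ℕ) : K :=
  ∏ i : Fin N, ∏ j ∈ Finset.range (lam i),
    (((lam i : K) - j - 1) / θ +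
      ((Finset.univ.filter fun k : Fin N => i < k ∧ j < lam k).card : K) + 1)

/-- The Jack polynomial `J_λ(x_1, …, x_N; θ) = c_λ P_λ(x_1, …, x_N)`. -/
def jackJ {K : Type*} [Field K] (θ : K) {N : ℕ} (lam : Fin N → ℕ) : MvPolynomial (Fin N) K :=
  jackFactor θ lam • SymFn.toVars N (jackP θ (toPartition lam))

/-! ### Eigenvalues -/

/-- `h^{(r)}_m(x_1, …, x_N)`: the sum of the complete homogeneous symmetric polynomials `h_m` in
`(x_i)_{i ∈ s}` over all `r`-element subsets `s`; it is zero for `m < 0`. -/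
def hSub {K : Type*} [Field K] {N : ℕ} (r : ℕ) (m : ℤ) (x : Fin N → K) : K :=
  if m < 0 then 0
  else ∑ s ∈ Finset.powersetCard r (Finset.univ : Finset (Fin N)),
    aeval (fun i : s => x i) (hsymm s K m.toNat)

/-- `ℓ_i = λ_i + θ (N - i)` for `1 ≤ i ≤ N`; here `i` is counted from 0. -/
def ell {K : Type*} [Field K] (θ : K) {N : ℕ} (lam : Fin N → ℕ) (i : Fin N) : K :=
  (lam i : K) + θ * ((N : K) - ((i : ℕ) + 1))

/-- `eig_m(λ) = ∑_{r=1}^N (-θ)^{r-1} h^{(r)}_{m+1-r}(ℓ_1, …, ℓ_N)`. -/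
def eig {K : Type*} [Field K] (θ : K) {N : ℕ} (lam : Fin N → ℕ) (m : ℕ) : K :=
  ∑ r ∈ Finset.Icc 1 N, (-θ) ^ (r - 1) * hSub r ((m : ℤ) + 1 - r) (ell θ lam)

/-- The upper triangular matrix with diagonal entries `ℓ_i` and all entries `-θ` above it. -/
def eigMatrix {K : Type*} [Field K] (θ : K) {N : ℕ} (lam : Fin N → ℕ) :
    Matrix (Fin N) (Fin N) K :=
  Matrix.of fun i j => if i = j then ell θ lam i else if i < j then -θ else 0

end HeckmanPolychronakos

end

noncomputable section

namespace HeckmanPolychronakos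

open MvPolynomial

/-! ### The deformed Hall form -/

section Hall

variable {K : Type*} [Field K]

/-! The argument has two independent halves: Jack functions are eigenfunctions because the operators
are both self-adjoint and triangular, and the eigenvalue is then read off from one coefficient.

Self-adjointness. On sums `∑ x_i^{k+1} f_k` with symmetric `f_k`, the operator `x_i D_i` acts on the
coefficient vector `(f_k)` through a matrix of operators on `Λ` that does not depend on `i` (`lax`,
`xDunkl_X_pow_mul`). Below the diagonal its entries are derivations in the power sums, above it
multiplications by power sums, and transposition sends each entry to its Hall adjoint. Starting from
a symmetric function and summing over `i`, which turns `x_i^{k+1}` into `p_{k+1}`, realizes the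
Heckman–Polychronakos operator as the self-adjoint operator `hpSym` (`toVars_hpSym`,
`isHallAdjoint_hpSym`).

Triangularity. Applied to a monomial, `x_i D_i` only moves two exponents towards each other or
exchanges them, so it preserves the span of the monomials dominated by a given partition
(`xDunkl_mem_domSpan`). Hence `hpSym` is triangular in the `m_μ`. For suitable `e`, `hpSym P_ν - e
P_ν` lies in the span of the lower `m_μ` and is orthogonal to it, so it vanishes by nondegeneracy
(`IsJackP.exists_hpSym_eq_smul`). Nondegeneracy also gives existence and uniqueness of `P_ν`: Gram
determinants are rational polynomials in `1/θ` without positive real roots, by positive definiteness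
(`det_gram_ne_zero`).

Eigenvalue. Only rearrangements of `λ` contribute to the coefficients of `(x_i D_i)^m P_λ` at
rearrangements of `λ`. These coefficients depend only on which part of `λ` stands at position `i`,
and each application of `x_i D_i` multiplies the resulting vector by `U` (`coeff_xDunkl_perm`).
Starting from the vector `1` and summing over `i` gives `1ᵀ U^m 1`; expanding it over increasing
chains of indices yields the formula with complete homogeneous polynomials
(`eigMatrix_pow_mulVec_one`). -/

/-- The norm `⟨p_a, p_a⟩`, where `p_a = ∏_k p_k ^ {a_k}`. -/
def hallWeight (θ : K) (a : ℕ+ →₀ ℕ) : K :=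
  a.prod fun (k : ℕ+) (r : ℕ) => (((k : ℕ) : K) / θ) ^ r * (r.factorial : K)

theorem hall_eq_sum_of_subset (θ : K) (f g : SymFn K) {s : Finset (ℕ+ →₀ ℕ)}
    (hs : f.support ⊆ s) :
    hall θ f g = ∑ a ∈ s, f.coeff a * g.coeff a * hallWeight θ a := by
  refine Finset.sum_subset hs fun a _ ha => ?_
  rw [notMem_support_iff.1 ha, zero_mul, zero_mul]

theorem hall_comm (θ : K) (f g : SymFn K) : hall θ f g = hall θ g f := by
  classical
  rw [hall_eq_sum_of_subset θ f g Finset.subset_union_left,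
    hall_eq_sum_of_subset θ g f (Finset.subset_union_right (s₁ := f.support))]
  exact Finset.sum_congr rfl fun a _ => by ring

theorem hall_add_right (θ : K) (f g g' : SymFn K) :
    hall θ f (g + g') = hall θ f g + hall θ f g' := by
  simp only [hall, coeff_add, mul_add, add_mul, Finset.sum_add_distrib]

theorem hall_smul_right (θ : K) (c : K) (f g : SymFn K) :
    hall θ f (c • g) = c * hall θ f g := by
  simp only [hall, coeff_smul, Finset.mul_sum, smul_eq_mul]
  exact Finset.sum_congr rfl fun a _ => by ring

/-- The deformed Hall product as a bilinear form. -/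
def hallForm (θ : K) : SymFn K →ₗ[K] SymFn K →ₗ[K] K :=
  LinearMap.mk₂ K (hall θ)
    (fun f f' g => by rw [hall_comm, hall_add_right, hall_comm θ g, hall_comm θ g])
    (fun c f g => by rw [hall_comm, hall_smul_right, hall_comm θ g, smul_eq_mul])
    (hall_add_right θ) (fun c f g => by rw [hall_smul_right, smul_eq_mul])

@[simp]
theorem hallForm_apply (θ : K) (f g : SymFn K) : hallForm θ f g = hall θ f g := rfl

theorem hall_monomial_left (θ : K) (a : ℕ+ →₀ ℕ) (c : K) (g : SymFn K) :
    hall θ (monomial a c) g = c * g.coeff a * hallWeight θ a := by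
  classical
  rw [hall_eq_sum_of_subset θ _ g support_monomial_subset, Finset.sum_singleton, coeff_monomial,
    if_pos rfl]

theorem hallWeight_add_single (θ : K) (a : ℕ+ →₀ ℕ) (k : ℕ+) :
    hallWeight θ (a + Finsupp.single k 1) =
      hallWeight θ a * (((k : ℕ) : K) / θ * ((a k : K) + 1)) := by
  classical
  have h (b : ℕ+ →₀ ℕ) : hallWeight θ b =
      ((((k : ℕ) : K) / θ) ^ b k * ((b k).factorial : K)) * hallWeight θ (b.erase k) := by
    exact (Finsupp.mul_prod_erase' b k _ (by simp)).symm
  rw [h, h a]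
  have he : (a + Finsupp.single k 1).erase k = a.erase k := by
    rw [Finsupp.erase_add, Finsupp.erase_single, add_zero]
  rw [he]
  simp only [Finsupp.add_apply, Finsupp.single_eq_same, Nat.factorial_succ, pow_succ]
  push_cast
  ring

/-- Multiplication by the power sum `p_k` is adjoint to `(k / θ) ∂ / ∂p_k`. -/
theorem hall_X_mul (θ : K) (k : ℕ+) (f g : SymFn K) :
    hall θ (X k * f) g = hall θ f ((((k : ℕ) : K) / θ) • pderiv k g) := by
  induction f using MvPolynomial.induction_on' with
  | add f₁ f₂ h₁ h₂ =>
    rw [mul_add]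
    change hallForm θ _ _ = hallForm θ _ _
    rw [map_add, map_add, LinearMap.add_apply, LinearMap.add_apply]
    exact congrArg₂ _ h₁ h₂
  | monomial a c =>
    have hX : (X k * monomial a c : SymFn K) = monomial (a + Finsupp.single k 1) c := by
      rw [mul_comm, X, monomial_mul, mul_one]
    rw [hX, hall_monomial_left, hall_monomial_left, hallWeight_add_single, coeff_smul,
      coeff_pderiv, smul_eq_mul]
    ring

/-- `S` and `T` are adjoint to each other for the deformed Hall form. -/
def IsHallAdjoint (θ : K) (S T : Module.End K (SymFn K)) : Prop :=
  ∀ f g, hall θ (S f) g = hall θ f (T g)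

namespace IsHallAdjoint

variable {θ : K} {S T S' T' : Module.End K (SymFn K)}

theorem symm (h : IsHallAdjoint θ S T) : IsHallAdjoint θ T S := fun f g => by
  rw [hall_comm, ← h, hall_comm]

theorem mul (h : IsHallAdjoint θ S T) (h' : IsHallAdjoint θ S' T') :
    IsHallAdjoint θ (S * S') (T' * T) := fun f g => by
  rw [Module.End.mul_apply, Module.End.mul_apply, h, h']

theorem smul (c : K) (h : IsHallAdjoint θ S T) : IsHallAdjoint θ (c • S) (c • T) := fun f g => by
  rw [LinearMap.smul_apply, LinearMap.smul_apply, hall_comm, hall_smul_right, hall_smul_right,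
    hall_comm, h]

theorem one : IsHallAdjoint θ 1 1 := fun _ _ => rfl

theorem sum {ι : Type*} (s : Finset ι) {S T : ι → Module.End K (SymFn K)}
    (h : ∀ i ∈ s, IsHallAdjoint θ (S i) (T i)) :
    IsHallAdjoint θ (∑ i ∈ s, S i) (∑ i ∈ s, T i) := fun f g => by
  simp only [← hallForm_apply, LinearMap.sum_apply, map_sum]
  exact Finset.sum_congr rfl fun i hi => h i hi f g

/-- The powers of a self-adjoint matrix of operators are self-adjoint. -/
theorem matrix_pow {n : ℕ} {A : Matrix (Fin n) (Fin n) (Module.End K (SymFn K))}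
    (h : ∀ k l, IsHallAdjoint θ (A k l) (A l k)) (m : ℕ) (k l : Fin n) :
    IsHallAdjoint θ ((A ^ m) k l) ((A ^ m) l k) := by
  induction m generalizing k l with
  | zero =>
    rw [pow_zero, Matrix.one_apply, Matrix.one_apply]
    by_cases hkl : k = l
    · simp only [hkl, if_true]
      exact one
    · rw [if_neg hkl, if_neg (Ne.symm hkl)]
      intro f g
      simp only [← hallForm_apply, LinearMap.zero_apply, map_zero]
  | succ m ih =>
    -- Adjunction reverses products, so the last factor is split off on one side and the first
    -- factor on the other.
    rw [pow_succ, Matrix.mul_apply, ← pow_succ, pow_succ', Matrix.mul_apply]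
    exact sum _ fun j _ => (ih k j).mul (h j l)

end IsHallAdjoint

end Hall

/-! ### The Lax matrix -/

section Lax

variable {K : Type*} [Field K]

/-- Multiplication by the power sum `p_{k+1}`. -/
def pMul (k : ℕ) : Module.End K (SymFn K) := LinearMap.mulLeft K (X k.succPNat)

/-- The operator `(k + 1) ∂ / ∂p_{k+1}`. -/
def pDer (k : ℕ) : Module.End K (SymFn K) := ((k : K) + 1) • (pderiv k.succPNat).toLinearMap

theorem pMul_apply (k : ℕ) (f : SymFn K) : pMul k f = X k.succPNat * f := rfl

theorem pDer_apply (k : ℕ) (f : SymFn K) : pDer k f = ((k : K) + 1) • pderiv k.succPNat f := rfl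

theorem isHallAdjoint_pMul_pDer {θ : K} (hθ : θ ≠ 0) (k : ℕ) :
    IsHallAdjoint θ (θ • pMul k) (pDer k) := fun f g => by
  rw [LinearMap.smul_apply, hall_comm, hall_smul_right, hall_comm, pMul_apply, hall_X_mul,
    ← hall_smul_right, pDer_apply, smul_smul, mul_div_cancel₀ _ hθ]
  simp

/-- The Lax matrix: the matrix of operators on symmetric functions through which `x_i D_i` acts on
the span of `f x_i ^ {k+1}`, `k < n`, with `f` symmetric. The parameter `c` is the value of
`p_0`. -/
def lax (θ c : K) (n : ℕ) : Matrix (Fin n) (Fin n) (Module.End K (SymFn K)) :=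
  Matrix.of fun k l =>
    if (l : ℕ) < k then pDer (k - l - 1)
    else if (k : ℕ) < l then θ • pMul (l - k - 1)
    else ((1 - θ) * ((k : K) + 1) + θ * c) • 1

/-- The action of the Heckman–Polychronakos operator `P_{m+1}` on symmetric functions of
degree `n`, with `p_0 = c`. -/
def hpSym (θ c : K) (n m : ℕ) : Module.End K (SymFn K) :=
  ∑ k : Fin n, ∑ l : Fin n, pMul k * (lax θ c n ^ m) k l * pDer l

/-- Transposition exchanges `θ p_d` above the diagonal with `d ∂/∂p_d` below it, and these are
adjoint; the diagonal is scalar. -/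
theorem isHallAdjoint_lax {θ : K} (hθ : θ ≠ 0) (c : K) (n : ℕ) (k l : Fin n) :
    IsHallAdjoint θ (lax θ c n k l) (lax θ c n l k) := by
  simp only [lax, Matrix.of_apply]
  rcases lt_trichotomy (k : ℕ) l with h | h | h
  · rw [if_neg h.not_gt, if_pos h, if_pos h]
    exact isHallAdjoint_pMul_pDer hθ _
  · obtain rfl := Fin.ext h
    simpa using IsHallAdjoint.one.smul _
  · rw [if_pos h, if_neg h.not_gt, if_pos h]
    exact (isHallAdjoint_pMul_pDer hθ _).symm

/-- Taking adjoints transposes the power of the Lax matrix and exchanges the outer multiplication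
and derivation, so the double sum is mapped to itself with `k` and `l` interchanged. -/
theorem isHallAdjoint_hpSym {θ : K} (hθ : θ ≠ 0) (c : K) (n m : ℕ) :
    IsHallAdjoint θ (hpSym θ c n m) (hpSym θ c n m) := by
  -- The adjoint of `pDer` is `θ • pMul`, so a factor `θ` is inserted here and removed at the end.
  have h : IsHallAdjoint θ (θ • hpSym θ c n m) (θ • hpSym θ c n m) := by
    have e₁ : θ • hpSym θ c n m =
        ∑ k : Fin n, ∑ l : Fin n, (θ • pMul k) * (lax θ c n ^ m) k l * pDer l := by
      simp only [hpSym, Finset.smul_sum, smul_mul_assoc]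
    have e₂ : θ • hpSym θ c n m =
        ∑ k : Fin n, ∑ l : Fin n, (θ • pMul l) * ((lax θ c n ^ m) l k * pDer k) := by
      rw [Finset.sum_comm]
      simp only [e₁, mul_assoc]
    nth_rewrite 2 [e₂]
    rw [e₁]
    refine IsHallAdjoint.sum _ fun k _ => IsHallAdjoint.sum _ fun l _ => ?_
    exact ((isHallAdjoint_pMul_pDer hθ k).mul
      (IsHallAdjoint.matrix_pow (isHallAdjoint_lax hθ c n) m k l)).mul
      (isHallAdjoint_pMul_pDer hθ l).symm
  have h' := h.smul θ⁻¹
  rwa [smul_smul, inv_mul_cancel₀ hθ, one_smul] at h'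

end Lax

/-! ### Homogeneous symmetric functions -/

section Homog

variable {K : Type*} [Field K]

/-- `f` is a homogeneous symmetric function of degree `n`, where `p_k` has degree `k`. -/
abbrev IsHomog (f : SymFn K) (n : ℕ) : Prop :=
  IsWeightedHomogeneous (fun k : ℕ+ => (k : ℕ)) f n

theorem IsHomog.smul {f : SymFn K} {n : ℕ} (hf : IsHomog f n) (c : K) : IsHomog (c • f) n :=
  (weightedHomogeneousSubmodule K (fun k : ℕ+ => (k : ℕ)) n).smul_mem c hf

theorem IsHomog.le_of_mem_vars {f : SymFn K} {n : ℕ} (hf : IsHomog f n) {k : ℕ+}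
    (hk : k ∈ f.vars) : (k : ℕ) ≤ n := by
  obtain ⟨d, hd, hkd⟩ := (mem_vars_iff_mem_support k).1 hk
  rw [← hf (mem_support_iff.1 hd)]
  exact Finsupp.le_weight_of_ne_zero' _ (Finsupp.mem_support_iff.1 hkd)

theorem IsHomog.pDer_eq_zero {f : SymFn K} {n k : ℕ} (hf : IsHomog f n) (hk : n ≤ k) :
    pDer k f = 0 := by
  rw [pDer_apply, pderiv_eq_zero_of_notMem_vars, smul_zero]
  intro h
  have := hf.le_of_mem_vars h
  simp at this
  omega

theorem IsHomog.pDer {f : SymFn K} {n k m : ℕ} (hf : IsHomog f n) (h : m + (k + 1) = n) :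
    IsHomog (pDer k f) m := by
  rw [pDer_apply]
  exact IsHomog.smul (IsWeightedHomogeneous.pderiv hf (by simpa using h)) _

theorem IsHomog.pMul {f : SymFn K} {n k m : ℕ} (hf : IsHomog f n) (h : n + (k + 1) = m) :
    IsHomog (pMul k f) m := by
  rw [pMul_apply, ← h, add_comm]
  exact (isWeightedHomogeneous_X K _ _).mul hf

/-- The `l`-th component is the coefficient of `x_i^{l+1}` in a polynomial of total degree `n`. This
grading is why truncating the Lax matrix at size `n` loses nothing. -/
theorem isHomog_lax (θ c : K) {n : ℕ} (k l : Fin n) {v : SymFn K} (hv : IsHomog v (n - (l + 1))) :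
    IsHomog (lax θ c n k l v) (n - (k + 1)) := by
  have hk := k.2
  have hl := l.2
  simp only [lax, Matrix.of_apply]
  split_ifs with h₁ h₂
  · exact hv.pDer (by omega)
  · exact IsHomog.smul (hv.pMul (by omega)) θ
  · obtain rfl : k = l := Fin.ext (by omega)
    exact hv.smul _

theorem isHomog_lax_pow (θ c : K) {n : ℕ} (m : ℕ) (k l : Fin n) {v : SymFn K}
    (hv : IsHomog v (n - (l + 1))) : IsHomog ((lax θ c n ^ m) k l v) (n - (k + 1)) := by
  induction m generalizing k with
  | zero =>
    rw [pow_zero, Matrix.one_apply]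
    split_ifs with h
    · obtain rfl := h
      exact hv
    · exact isWeightedHomogeneous_zero _ _ _
  | succ m ih =>
    rw [pow_succ', Matrix.mul_apply, LinearMap.sum_apply]
    exact IsWeightedHomogeneous.sum _ _ _ fun j _ => isHomog_lax θ c k j (ih j)

theorem isHomog_hpSym (θ c : K) (n m : ℕ) {f : SymFn K} (hf : IsHomog f n) :
    IsHomog (hpSym θ c n m f) n := by
  rw [hpSym, LinearMap.sum_apply]
  refine IsWeightedHomogeneous.sum _ _ _ fun k _ => ?_
  rw [LinearMap.sum_apply]
  refine IsWeightedHomogeneous.sum _ _ _ fun l _ => ?_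
  exact (isHomog_lax_pow θ c m k l (hf.pDer (by omega))).pMul (by omega)

end Homog

/-! ### Dunkl operators on symmetric functions -/

section Intertwining

variable {K : Type*} [Field K] {N : ℕ}

theorem toVars_X (k : ℕ+) : SymFn.toVars N (X k : SymFn K) = psum (Fin N) K k := by
  rw [SymFn.toVars, aeval_X]

theorem toVars_isSymmetric (f : SymFn K) : (SymFn.toVars N f).IsSymmetric := by
  intro e
  have : (rename e : MvPolynomial (Fin N) K →ₐ[K] _).comp (SymFn.toVars N) = SymFn.toVars N := by
    apply algHom_ext
    intro k
    rw [AlgHom.comp_apply, toVars_X, rename_psum]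
  exact congrArg (fun φ => φ f) this

/-- The chain rule with `∂p_l/∂x_i = l x_i^{l-1}`: both sides obey the Leibniz rule, so generators
suffice. -/
theorem pderiv_toVars (i : Fin N) (s : Finset ℕ+) {f : SymFn K}
    (hf : f ∈ supported K (s : Set ℕ+)) :
    pderiv i (SymFn.toVars N f) =
      ∑ l ∈ s, ((l : ℕ) : K) • (X i ^ ((l : ℕ) - 1) * SymFn.toVars N (pderiv l f)) := by
  classical
  induction hf using Algebra.adjoin_induction with
  | mem x hx =>
    obtain ⟨k, hk, rfl⟩ := hx
    rw [toVars_X, psum, map_sum, Finset.sum_eq_single_of_mem i (Finset.mem_univ _),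
      Finset.sum_eq_single_of_mem k hk]
    · rw [pderiv_pow, pderiv_X_self, pderiv_X_self, map_one, mul_one, mul_one, smul_eq_C_mul,
        map_natCast]
    · intro l _ hl
      rw [pderiv_X_of_ne (Ne.symm hl), map_zero, mul_zero, smul_zero]
    · intro j _ hj
      rw [pderiv_pow, pderiv_X_of_ne hj, mul_zero]
  | algebraMap r =>
    rw [AlgHom.commutes, algebraMap_eq, algebraMap_eq, pderiv_C, Finset.sum_eq_zero]
    intro l _
    rw [pderiv_C, map_zero, mul_zero, smul_zero]
  | add f g _ _ hf hg =>
    simp only [map_add, hf, hg, mul_add, smul_add, Finset.sum_add_distrib]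
  | mul f g _ _ hf hg =>
    rw [map_mul, pderiv_mul, hf, hg, Finset.sum_mul, Finset.mul_sum, ← Finset.sum_add_distrib]
    refine Finset.sum_congr rfl fun l _ => ?_
    simp only [pderiv_mul, map_add, map_mul, smul_eq_C_mul]
    ring

theorem X_mul_pderiv_toVars (i : Fin N) {f : SymFn K} {n r : ℕ} (hf : IsHomog f n) (hr : n ≤ r) :
    X i * pderiv i (SymFn.toVars N f) =
      ∑ l ∈ Finset.range r, X i ^ (l + 1) * SymFn.toVars N (pDer l f) := by
  have hs : f ∈ supported K
      (((Finset.range r).map ⟨Nat.succPNat, Nat.succPNat_injective⟩ : Finset ℕ+) : Set ℕ+) := by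
    rw [mem_supported]
    intro k hk
    have := hf.le_of_mem_vars hk
    have h0 := k.pos
    simp only [Finset.coe_map, Function.Embedding.coeFn_mk, Finset.coe_range, Set.mem_image,
      Set.mem_Iio]
    exact ⟨(k : ℕ) - 1, by omega, PNat.eq (by simp; omega)⟩
  rw [pderiv_toVars i _ hs, Finset.sum_map, Finset.mul_sum]
  refine Finset.sum_congr rfl fun l _ => ?_
  simp only [Function.Embedding.coeFn_mk, Nat.succPNat_coe, Nat.succ_eq_add_one, pDer_apply,
    map_smul, add_tsub_cancel_right]
  simp only [smul_eq_C_mul, pow_succ]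
  push_cast
  ring

/-- The operator `x_i D_i`. -/
def xDunkl (θ : K) (i : Fin N) : Module.End K (MvPolynomial (Fin N) K) :=
  LinearMap.mulLeft K (X i) * dunkl θ i

theorem xDunkl_apply (θ : K) (i : Fin N) (f : MvPolynomial (Fin N) K) :
    xDunkl θ i f = X i * pderiv i f +
      θ • ∑ j : {j : Fin N // j ≠ i}, X i * diffQuot K j.2 f := by
  simp only [xDunkl, dunkl, Module.End.mul_apply, LinearMap.mulLeft_apply, LinearMap.add_apply,
    LinearMap.smul_apply, LinearMap.sum_apply, mul_add, mul_smul_comm, Finset.mul_sum]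
  rfl

/-- The invariant factor comes out, and `(x_i^k - x_j^k) / (x_i - x_j)` is a geometric sum. -/
theorem diffQuot_X_pow_mul {i j : Fin N} (h : j ≠ i) (k : ℕ) {F : MvPolynomial (Fin N) K}
    (hF : rename (Equiv.swap i j) F = F) :
    diffQuot K h (X i ^ k * F) = (∑ a ∈ Finset.range k, X i ^ a * X j ^ (k - 1 - a)) * F := by
  apply mul_left_cancel₀ (X_sub_X_ne_zero (K := K) h)
  rw [mul_diffQuot, map_mul, map_pow, rename_X, Equiv.swap_apply_left, hF, ← mul_assoc,
    mul_comm (X i - X j), (Commute.all _ _).geom_sum₂_mul, sub_mul]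

theorem sum_ne_pow (i : Fin N) (k : ℕ) :
    ∑ j : {j : Fin N // j ≠ i}, (X j.1 : MvPolynomial (Fin N) K) ^ k =
      psum (Fin N) K k - X i ^ k := by
  rw [psum, ← Finset.sum_erase_eq_sub (Finset.mem_univ i)]
  exact (Finset.sum_subtype (Finset.univ.erase i) (p := fun j => j ≠ i) (fun j => by simp)
    fun j => (X j : MvPolynomial (Fin N) K) ^ k).symm

theorem xDunkl_of_isSymmetric (θ : K) (i : Fin N) {F : MvPolynomial (Fin N) K}
    (hF : F.IsSymmetric) : xDunkl θ i F = X i * pderiv i F := by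
  have h : ∀ j : {j : Fin N // j ≠ i}, diffQuot K j.2 F = 0 := fun j => by
    simpa using diffQuot_X_pow_mul j.2 0 (hF _)
  rw [xDunkl_apply]
  simp [h]

/-- Summing the geometric sums over `j ≠ i` replaces powers of `x_j` by `p_{k-a} - x_i^{k-a}`. The
subtracted terms contribute `-x_i^{k+1}` each, `k + 1` times in all, and the term `a = k`
contributes `p_0 = N`; this produces the diagonal coefficient. -/
theorem xDunkl_X_pow_mul (θ : K) (i : Fin N) (k : ℕ) {F : MvPolynomial (Fin N) K}
    (hF : F.IsSymmetric) :
    xDunkl θ i (X i ^ (k + 1) * F) = X i ^ (k + 1) * (X i * pderiv i F) +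
      (((1 - θ) * ((k : K) + 1) + θ * N) • (X i ^ (k + 1) * F) +
      ∑ a ∈ Finset.range k, X i ^ (a + 1) * (θ • (psum (Fin N) K (k - a) * F))) := by
  have hd : ∑ j : {j : Fin N // j ≠ i}, X i * diffQuot K j.2 (X i ^ (k + 1) * F) =
      (∑ a ∈ Finset.range k, X i ^ (a + 1) * psum (Fin N) K (k - a)) * F +
        ((N : MvPolynomial (Fin N) K) - ((k : MvPolynomial (Fin N) K) + 1)) *
          (X i ^ (k + 1) * F) := by
    simp only [diffQuot_X_pow_mul _ _ (hF _), ← mul_assoc]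
    rw [← Finset.sum_mul, ← add_mul]
    congr 1
    simp only [Finset.mul_sum]
    rw [Finset.sum_comm]
    have : ∀ a ∈ Finset.range (k + 1), ∑ j : {j : Fin N // j ≠ i},
        (X i * (X i ^ a * X j.1 ^ (k + 1 - 1 - a)) : MvPolynomial (Fin N) K) =
          X i ^ (a + 1) * psum (Fin N) K (k - a) - X i ^ (k + 1) := by
      intro a ha
      have ha' : a + 1 + (k - a) = k + 1 := by
        have := Finset.mem_range.1 ha
        omega
      simp only [← mul_assoc, ← pow_succ', add_tsub_cancel_right]
      rw [← Finset.mul_sum, sum_ne_pow, mul_sub, ← pow_add, ha']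
    rw [Finset.sum_congr rfl this, Finset.sum_sub_distrib, Finset.sum_range_succ, Finset.sum_const,
      Finset.card_range, tsub_self, psum_zero, Fintype.card_fin, nsmul_eq_mul]
    push_cast
    ring
  rw [xDunkl_apply, hd, pderiv_mul, pderiv_pow, pderiv_X_self]
  simp only [mul_smul_comm, ← Finset.smul_sum, ← mul_assoc, ← Finset.sum_mul]
  simp only [smul_eq_C_mul, map_add, map_sub, map_mul, map_natCast, map_one,
    add_tsub_cancel_right, pow_succ]
  push_cast
  ring

/-- Column by column this is `xDunkl_X_pow_mul`: power sums fill the rows above the diagonal, the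
expansion of `x_i ∂_i` in derivatives by power sums fills those below, and the shift changes `p_0`
from `N` to `c`. -/
theorem xDunkl_add_smul_eq_lax (θ c : K) (i : Fin N) {n : ℕ} {v : Fin n → SymFn K}
    (hv : ∀ k, IsHomog (v k) (n - (k + 1))) :
    (xDunkl θ i + (θ * (c - N)) • 1) (∑ k : Fin n, X i ^ ((k : ℕ) + 1) * SymFn.toVars N (v k)) =
      ∑ k : Fin n, X i ^ ((k : ℕ) + 1) * SymFn.toVars N (∑ l, lax θ c n k l (v l)) := by
  simp only [map_sum, Finset.mul_sum]
  rw [Finset.sum_comm]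
  refine Finset.sum_congr rfl fun l _ => ?_
  have hl := l.2
  rw [LinearMap.add_apply, LinearMap.smul_apply, Module.End.one_apply,
    xDunkl_X_pow_mul θ i l (toVars_isSymmetric _), X_mul_pderiv_toVars i (hv l) le_rfl]
  set G : ℕ → MvPolynomial (Fin N) K := fun k =>
    X i ^ (k + 1) * SymFn.toVars N
      ((if (l : ℕ) < k then pDer (k - l - 1) else if k < l then θ • pMul (l - k - 1)
        else ((1 - θ) * ((k : K) + 1) + θ * c) • (1 : Module.End K (SymFn K))) (v l)) with hG
  have hR : ∑ k : Fin n, X i ^ ((k : ℕ) + 1) * SymFn.toVars N (lax θ c n k l (v l)) =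
      ∑ k ∈ Finset.range n, G k := (Finset.sum_range G).symm
  have hn : Finset.range n = Finset.range (l + (1 + (n - (l + 1)))) := by
    congr 1
    omega
  rw [hR, hn, Finset.sum_range_add,
    Finset.sum_range_add _ 1, Finset.sum_range_one]
  have h₁ : ∑ a ∈ Finset.range l, G a = ∑ a ∈ Finset.range l, X i ^ (a + 1) *
      (θ • (psum (Fin N) K (l - a) * SymFn.toVars N (v l))) := by
    refine Finset.sum_congr rfl fun a ha => ?_
    have ha := Finset.mem_range.1 ha
    simp only [hG]
    rw [if_neg (by omega), if_pos ha, LinearMap.smul_apply, map_smul, pMul_apply, map_mul, toVars_X]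
    simp only [Nat.succPNat_coe, Nat.succ_eq_add_one]
    rw [show (l : ℕ) - a - 1 + 1 = l - a by omega]
  have h₂ : G (l + 0) = ((1 - θ) * ((l : K) + 1) + θ * c) •
      (X i ^ ((l : ℕ) + 1) * SymFn.toVars N (v l)) := by
    simp only [hG, add_zero, lt_irrefl, if_false, LinearMap.smul_apply, map_smul,
      Module.End.one_apply, mul_smul_comm]
  have h₃ : ∑ x ∈ Finset.range (n - (l + 1)), G (l + (1 + x)) = X i ^ ((l : ℕ) + 1) *
      ∑ a ∈ Finset.range (n - (l + 1)), X i ^ (a + 1) * SymFn.toVars N (pDer a (v l)) := by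
    rw [Finset.mul_sum]
    refine Finset.sum_congr rfl fun a ha => ?_
    simp only [hG]
    rw [if_pos (by omega), show (l : ℕ) + (1 + a) - l - 1 = a by omega, ← mul_assoc, ← pow_add]
    congr 2
    ring
  rw [h₁, h₂, h₃]
  simp only [smul_eq_C_mul, map_add, map_mul, map_sub, map_natCast, map_one]
  ring

/-- In `N` variables the operator `hpSym` becomes the Heckman–Polychronakos operator, up to the
shift by `θ (c - N)`. -/
theorem toVars_hpSym (θ c : K) (n m : ℕ) {f : SymFn K} (hf : IsHomog f n) :
    SymFn.toVars N (hpSym θ c n m f) =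
      ∑ i, ((xDunkl θ i + (θ * (c - N)) • 1) ^ m) (xDunkl θ i (SymFn.toVars N f)) := by
  -- On a symmetric function the difference quotients vanish, so the first `x_i D_i` gives the
  -- vector `(pDer l f)`; every further factor multiplies it by the Lax matrix.
  have key : ∀ (i : Fin N) (m : ℕ),
      ((xDunkl θ i + (θ * (c - N)) • 1) ^ m) (xDunkl θ i (SymFn.toVars N f)) =
        ∑ k : Fin n, X i ^ ((k : ℕ) + 1) *
          SymFn.toVars N (∑ l : Fin n, (lax θ c n ^ m) k l (pDer l f)) := by
    intro i m
    induction m with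
    | zero =>
      rw [pow_zero, pow_zero, Module.End.one_apply,
        xDunkl_of_isSymmetric θ i (toVars_isSymmetric f),
        X_mul_pderiv_toVars i hf le_rfl, Finset.sum_range]
      refine Finset.sum_congr rfl fun k _ => ?_
      rw [Finset.sum_eq_single_of_mem k (Finset.mem_univ k)]
      · rw [Matrix.one_apply_eq, Module.End.one_apply]
      · intro l _ hl
        rw [Matrix.one_apply_ne (Ne.symm hl), LinearMap.zero_apply]
    | succ m ih =>
      rw [pow_succ', Module.End.mul_apply, ih, xDunkl_add_smul_eq_lax]
      · refine Finset.sum_congr rfl fun k _ => ?_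
        congr 2
        simp only [pow_succ', Matrix.mul_apply, LinearMap.sum_apply, map_sum, Module.End.mul_apply]
        rw [Finset.sum_comm]
      · intro k
        exact IsWeightedHomogeneous.sum _ _ _ fun l _ =>
          isHomog_lax_pow θ c m k l (hf.pDer (by omega))
  simp only [key]
  -- The coefficients of `x_i^{k+1}` are the same for all `i`, so the sum over `i` only produces
  -- `p_{k+1}`.
  rw [Finset.sum_comm, hpSym, LinearMap.sum_apply, map_sum]
  refine Finset.sum_congr rfl fun k _ => ?_
  rw [← Finset.sum_mul]
  simp only [LinearMap.sum_apply, map_sum, Module.End.mul_apply, pMul_apply, map_mul, toVars_X,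
    psum, Nat.succPNat_coe, Nat.succ_eq_add_one, Finset.mul_sum]

theorem toVars_hpSym_self (θ : K) (n m : ℕ) {f : SymFn K} (hf : IsHomog f n) :
    SymFn.toVars N (hpSym θ N n m f) = hpOp N θ (m + 1) (SymFn.toVars N f) := by
  rw [toVars_hpSym θ N n m hf, sub_self, mul_zero, zero_smul]
  simp only [add_zero, hpOp, LinearMap.sum_apply, pow_succ]
  rfl

end Intertwining

/-! ### The dominance order -/

section Dominance

/-- Induction with an exchange: if the head of `l` occurs in `s`, cancel it; otherwise compare it
with any element of `s`, which is no larger. -/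
theorem sum_le_sum_take {l : List ℕ} (hl : l.Pairwise (· ≥ ·)) (k : ℕ) {s : Multiset ℕ}
    (hs : s ≤ (l : Multiset ℕ)) (hk : s.card ≤ k) : s.sum ≤ (l.take k).sum := by
  induction l generalizing k s with
  | nil =>
    obtain rfl : s = 0 := Multiset.le_zero.1 hs
    simp
  | cons x l ih =>
    rw [List.pairwise_cons] at hl
    rcases Multiset.empty_or_exists_mem s with rfl | ⟨y, hy⟩
    · simp
    obtain ⟨k, rfl⟩ : ∃ k', k = k' + 1 :=
      Nat.exists_eq_succ_of_ne_zero ((Multiset.card_pos_iff_exists_mem.2 ⟨y, hy⟩).trans_le hk).ne'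
    rw [List.take_succ_cons, List.sum_cons]
    rw [← Multiset.cons_coe] at hs
    by_cases hx : x ∈ s
    · obtain ⟨s, rfl⟩ := Multiset.exists_cons_of_mem hx
      rw [Multiset.sum_cons]
      rw [Multiset.card_cons] at hk
      exact Nat.add_le_add_left (ih hl.2 k ((Multiset.cons_le_cons_iff x).1 hs) (by omega)) x
    · have hs' := (Multiset.le_cons_of_notMem hx).1 hs
      obtain ⟨s, rfl⟩ := Multiset.exists_cons_of_mem hy
      rw [Multiset.sum_cons]
      rw [Multiset.card_cons] at hk
      exact Nat.add_le_add (hl.1 y (Multiset.mem_coe.1 (Multiset.mem_of_le hs' hy)))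
        (ih hl.2 k ((Multiset.le_cons_self s y).trans hs') (by omega))

theorem sum_le_partialSum {n : ℕ} (μ : n.Partition) {k : ℕ} {s : Multiset ℕ} (hs : s ≤ μ.parts)
    (hk : s.card ≤ k) : s.sum ≤ partialSum μ k :=
  sum_le_sum_take (Multiset.pairwise_sort _ _) k (by rwa [Multiset.sort_eq]) hk

/-- With `sum_le_partialSum` this presents `partialSum` as a maximum over sub-multisets, so that
exponent vectors can be compared without sorting. -/
theorem exists_sum_eq_partialSum {n : ℕ} (μ : n.Partition) (k : ℕ) :
    ∃ s ≤ μ.parts, s.card ≤ k ∧ s.sum = partialSum μ k := by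
  refine ⟨((μ.parts.sort (· ≥ ·)).take k : List ℕ), ?_, ?_, ?_⟩
  · conv_rhs => rw [← Multiset.sort_eq μ.parts (· ≥ ·)]
    exact Multiset.coe_le.2 (List.take_sublist _ _).subperm
  · simp
  · simp [partialSum]

theorem partialSum_mono {n : ℕ} (μ : n.Partition) {k l : ℕ} (h : k ≤ l) :
    partialSum μ k ≤ partialSum μ l := by
  obtain ⟨s, hs, hc, he⟩ := exists_sum_eq_partialSum μ k
  exact he ▸ sum_le_partialSum μ hs (hc.trans h)

theorem DomLE.refl {n : ℕ} (μ : n.Partition) : DomLE μ μ := fun _ => le_rfl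

theorem DomLE.trans {n : ℕ} {μ ν ρ : n.Partition} (h : DomLE μ ν) (h' : DomLE ν ρ) : DomLE μ ρ :=
  fun k => (h k).trans (h' k)

theorem eq_of_sum_take_eq {l l' : List ℕ} (hl : ∀ x ∈ l, 0 < x) (hl' : ∀ x ∈ l', 0 < x)
    (h : ∀ k, (l.take k).sum = (l'.take k).sum) : l = l' := by
  induction l generalizing l' with
  | nil =>
    rcases l' with _ | ⟨y, l'⟩
    · rfl
    · have := h 1
      have := hl' y (by simp)
      simp at *
      omega
  | cons x l ih =>
    rcases l' with _ | ⟨y, l'⟩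
    · have := h 1
      have := hl x (by simp)
      simp at *
      omega
    · obtain rfl : x = y := by simpa using h 1
      rw [ih (l' := l') (fun z hz => hl z (by simp [hz])) (fun z hz => hl' z (by simp [hz]))]
      intro k
      simpa using h (k + 1)

theorem DomLE.antisymm {n : ℕ} {μ ν : n.Partition} (h : DomLE μ ν) (h' : DomLE ν μ) : μ = ν := by
  have e : μ.parts.sort (· ≥ ·) = ν.parts.sort (· ≥ ·) :=
    eq_of_sum_take_eq (fun x hx => μ.parts_pos ((Multiset.mem_sort _).1 hx))
      (fun x hx => ν.parts_pos ((Multiset.mem_sort _).1 hx)) fun k => le_antisymm (h k) (h' k)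
  ext1
  rw [← Multiset.sort_eq μ.parts (· ≥ ·), e, Multiset.sort_eq]

/-- The partition formed by the nonzero values of `a`. -/
def expPartition {N n : ℕ} (a : Fin N → ℕ) (h : ∑ i, a i = n) : n.Partition :=
  Nat.Partition.ofSums n (Finset.univ.val.map a) h

theorem expPartition_parts {N n : ℕ} (a : Fin N → ℕ) (h : ∑ i, a i = n) :
    (expPartition a h).parts = (Finset.univ.val.map a).filter (· ≠ 0) := rfl

/-- The exponent vector `a`, once sorted, is dominated by `lam`. -/
def ExpLE {N n : ℕ} (a : Fin N → ℕ) (lam : n.Partition) : Prop :=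
  ∑ i, a i = n ∧ ∀ T : Finset (Fin N), ∑ i ∈ T, a i ≤ partialSum lam T.card

theorem exists_map_eq_of_le_map {α β : Type*} (f : α → β) (s : Multiset α) {t : Multiset β}
    (h : t ≤ s.map f) : ∃ u ≤ s, u.map f = t := by
  induction s using Multiset.induction_on generalizing t with
  | empty => exact ⟨0, le_rfl, by simpa using (Multiset.le_zero.1 h).symm⟩
  | cons x s ih =>
    rw [Multiset.map_cons] at h
    by_cases hx : f x ∈ t
    · obtain ⟨t, rfl⟩ := Multiset.exists_cons_of_mem hx
      obtain ⟨u, hu, rfl⟩ := ih ((Multiset.cons_le_cons_iff _).1 h)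
      exact ⟨x ::ₘ u, (Multiset.cons_le_cons_iff _).2 hu, Multiset.map_cons _ _ _⟩
    · obtain ⟨u, hu, rfl⟩ := ih ((Multiset.le_cons_of_notMem hx).1 h)
      exact ⟨u, hu.trans (Multiset.le_cons_self _ _), rfl⟩

theorem sum_filter_ne_zero (s : Multiset ℕ) : (s.filter (· ≠ 0)).sum = s.sum := by
  conv_rhs => rw [← Multiset.filter_add_not (· ≠ 0) s, Multiset.sum_add]
  have : (s.filter fun x => ¬ x ≠ 0).sum = 0 :=
    Multiset.sum_eq_zero fun x hx => not_not.1 (Multiset.mem_filter.1 hx).2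
  rw [this, add_zero]

/-- Sub-multisets of the values of `a` lift to index sets, and the discarded zeros do not affect
sums. -/
theorem expLE_iff {N n : ℕ} {a : Fin N → ℕ} (h : ∑ i, a i = n) {lam : n.Partition} :
    ExpLE a lam ↔ DomLE (expPartition a h) lam := by
  constructor
  · intro hd k
    obtain ⟨s, hs, hc, he⟩ := exists_sum_eq_partialSum (expPartition a h) k
    rw [expPartition_parts] at hs
    obtain ⟨u, hu, rfl⟩ := exists_map_eq_of_le_map a _ (hs.trans (Multiset.filter_le _ _))
    have := hd.2 ⟨u, Multiset.nodup_of_le hu Finset.univ.nodup⟩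
    rw [← he]
    exact this.trans (partialSum_mono _ (by simpa using hc))
  · refine fun hd => ⟨h, fun T => le_trans ?_ (hd T.card)⟩
    have hle : T.val.map a ≤ Finset.univ.val.map a :=
      Multiset.map_le_map (Finset.val_le_iff.2 (Finset.subset_univ T))
    have := sum_le_partialSum (expPartition a h) (k := T.card)
      (Multiset.filter_le_filter (· ≠ 0) hle)
      ((Multiset.card_le_card (Multiset.filter_le _ _)).trans (by simp))
    rwa [sum_filter_ne_zero] at this

/-- Bringing two entries closer with fixed sum cannot increase dominance. Index sets containing both
or neither of `i`, `j` keep their sum; in a set containing exactly one, that index is replaced by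
whichever of `i`, `j` carries the larger entry of `a`. -/
theorem ExpLE.of_move {N n : ℕ} {a b : Fin N → ℕ} {lam : n.Partition} {i j : Fin N}
    (hij : i ≠ j) (hb : ∀ k, k ≠ i → k ≠ j → b k = a k) (hs : b i + b j = a i + a j)
    (hm : max (b i) (b j) ≤ max (a i) (a j)) (ha : ExpLE a lam) : ExpLE b lam := by
  classical
  have hT : ∀ T : Finset (Fin N), ∃ T' : Finset (Fin N), T'.card = T.card ∧
      ∑ k ∈ T, b k ≤ ∑ k ∈ T', a k := by
    intro T
    have hR : ∀ R : Finset (Fin N), i ∉ R → j ∉ R → ∑ k ∈ R, b k = ∑ k ∈ R, a k :=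
      fun R hi hj => Finset.sum_congr rfl fun k hk =>
        hb k (fun e => hi (e ▸ hk)) fun e => hj (e ▸ hk)
    have hone : ∀ (R : Finset (Fin N)) (l : Fin N), i ∉ R → j ∉ R → (l = i ∨ l = j) →
        ∃ T' : Finset (Fin N), T'.card = (insert l R).card ∧
          ∑ k ∈ insert l R, b k ≤ ∑ k ∈ T', a k := by
      intro R l hi hj hl
      have hlR : l ∉ R := by rcases hl with rfl | rfl <;> assumption
      have hle : b l ≤ max (a i) (a j) := by
        rcases hl with rfl | rfl
        · exact (le_max_left _ _).trans hm
        · exact (le_max_right _ _).trans hm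
      rcases le_max_iff.1 hle with h | h
      · exact ⟨insert i R, by simp [hi, hlR], by
          rw [Finset.sum_insert hlR, Finset.sum_insert hi, hR R hi hj]; omega⟩
      · exact ⟨insert j R, by simp [hj, hlR], by
          rw [Finset.sum_insert hlR, Finset.sum_insert hj, hR R hi hj]; omega⟩
    by_cases hi : i ∈ T <;> by_cases hj : j ∈ T
    · refine ⟨T, rfl, le_of_eq ?_⟩
      rw [← Finset.add_sum_erase T _ hi, ← Finset.add_sum_erase T a hi,
        ← Finset.add_sum_erase (T.erase i) _ (Finset.mem_erase.2 ⟨hij.symm, hj⟩),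
        ← Finset.add_sum_erase (T.erase i) a (Finset.mem_erase.2 ⟨hij.symm, hj⟩),
        hR _ (by simp) (by simp)]
      omega
    · have := hone (T.erase i) i (by simp) (by simp [hj]) (Or.inl rfl)
      rwa [Finset.insert_erase hi] at this
    · have := hone (T.erase j) j (by simp [hi]) (by simp) (Or.inr rfl)
      rwa [Finset.insert_erase hj] at this
    · exact ⟨T, rfl, (hR T hi hj).le⟩
  refine ⟨?_, fun T => ?_⟩
  · rw [← ha.1, ← Finset.add_sum_erase _ b (Finset.mem_univ i),
      ← Finset.add_sum_erase _ a (Finset.mem_univ i),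
      ← Finset.add_sum_erase _ b (Finset.mem_erase.2 ⟨hij.symm, Finset.mem_univ j⟩),
      ← Finset.add_sum_erase _ a (Finset.mem_erase.2 ⟨hij.symm, Finset.mem_univ j⟩),
      ← add_assoc, ← add_assoc, hs]
    congr 1
    refine Finset.sum_congr rfl fun k hk => ?_
    simp only [Finset.mem_erase] at hk
    exact hb k hk.2.1 hk.1
  · obtain ⟨T', hc, hle⟩ := hT T
    exact hle.trans (hc ▸ ha.2 T')

theorem sum_sq_eq_of_expPartition_eq {N n : ℕ} {a b : Fin N → ℕ} {ha : ∑ i, a i = n}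
    {hb : ∑ i, b i = n} (h : expPartition a ha = expPartition b hb) :
    ∑ i, a i ^ 2 = ∑ i, b i ^ 2 := by
  have key : ∀ (c : Fin N → ℕ) (hc : ∑ i, c i = n),
      ((expPartition c hc).parts.map (· ^ 2)).sum = ∑ i, c i ^ 2 := by
    intro c hc
    have : ((Finset.univ.val.map c).map (· ^ 2)).filter (· ≠ 0) =
        ((Finset.univ.val.map c).filter (· ≠ 0)).map (· ^ 2) := by
      rw [Multiset.filter_map]
      congr 2
      ext x
      simp
    rw [expPartition_parts, ← this, sum_filter_ne_zero, Multiset.map_map]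
    rfl
  rw [← key a ha, ← key b hb, h]

/-- A vector of type `lam` is not obtained from a vector dominated by `lam` by strictly decreasing
the larger one of two entries. -/
theorem not_strict_move {N n : ℕ} {a b : Fin N → ℕ} {i j : Fin N} (hbn : ∑ i, b i = n)
    (hij : i ≠ j) (hb : ∀ k, k ≠ i → k ≠ j → b k = a k) (hs : b i + b j = a i + a j)
    (hm : max (b i) (b j) < max (a i) (a j)) : ¬ ExpLE a (expPartition b hbn) := by
  intro ha
  have h₁ := ExpLE.of_move hij hb hs hm.le
    ((expLE_iff ha.1).2 (DomLE.refl (expPartition a ha.1)))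
  have h₂ := (expLE_iff hbn).1 h₁
  -- Antisymmetry forces the two partitions to coincide, whereas the sum of squares has strictly
  -- dropped.
  have h₃ := sum_sq_eq_of_expPartition_eq (h₂.antisymm ((expLE_iff ha.1).1 ha))
  rw [← Finset.add_sum_erase _ _ (Finset.mem_univ i),
    ← Finset.add_sum_erase _ (fun k => a k ^ 2) (Finset.mem_univ i),
    ← Finset.add_sum_erase _ _ (Finset.mem_erase.2 ⟨hij.symm, Finset.mem_univ j⟩),
    ← Finset.add_sum_erase _ (fun k => a k ^ 2)
      (Finset.mem_erase.2 ⟨hij.symm, Finset.mem_univ j⟩), ← add_assoc, ← add_assoc] at h₃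
  have h₄ : ∑ k ∈ (Finset.univ.erase i).erase j, b k ^ 2 =
      ∑ k ∈ (Finset.univ.erase i).erase j, a k ^ 2 := by
    refine Finset.sum_congr rfl fun k hk => ?_
    simp only [Finset.mem_erase] at hk
    rw [hb k hk.2.1 hk.1]
  rw [h₄] at h₃
  have h₅ := Nat.add_right_cancel h₃
  rcases max_cases (a i) (a j) with ⟨h, _⟩ | ⟨h, _⟩ <;> rw [h, max_lt_iff] at hm <;> nlinarith

end Dominance

/-! ### Dunkl operators on monomials -/

section Triangular

variable {K : Type*} [Field K] {N : ℕ}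

/-- The span of the monomials whose exponent vector is dominated by `lam`. -/
def domSpan (K : Type*) [Field K] (N : ℕ) {n : ℕ} (lam : n.Partition) :
    Submodule K (MvPolynomial (Fin N) K) :=
  restrictSupport K {a | ExpLE (a : Fin N → ℕ) lam}

theorem mem_domSpan_iff {n : ℕ} {lam : n.Partition} {f : MvPolynomial (Fin N) K} :
    f ∈ domSpan K N lam ↔ ∀ a, coeff a f ≠ 0 → ExpLE a lam := by
  rw [domSpan, mem_restrictSupport_iff]
  exact ⟨fun h a ha => h (mem_support_iff.2 ha), fun h a ha => h a (mem_support_iff.1 ha)⟩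

theorem monomial_mem_domSpan {n : ℕ} {lam : n.Partition} {a : Fin N →₀ ℕ} (ha : ExpLE a lam)
    (c : K) : monomial a c ∈ domSpan K N lam :=
  (monomial_mem_restrictSupport K).2 (Or.inl ha)

/-- This antisymmetry reduces monomials whose larger exponent is at `j` to those where it is at `i`.
-/
theorem diffQuot_rename_swap {i j : Fin N} (h : j ≠ i) (f : MvPolynomial (Fin N) K) :
    diffQuot K h (rename (Equiv.swap i j) f) = -diffQuot K h f := by
  apply mul_left_cancel₀ (X_sub_X_ne_zero (K := K) h)
  rw [mul_neg, mul_diffQuot, mul_diffQuot, rename_rename, ← Equiv.coe_trans, Equiv.swap_swap,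
    Equiv.coe_refl, rename_id_apply, neg_sub]

theorem rename_swap_monomial {i j : Fin N} {a : Fin N →₀ ℕ} (ha : a i = a j) (d : ℕ) (c : K) :
    rename (Equiv.swap i j) (monomial (a + Finsupp.single i d) c) =
      monomial (a + Finsupp.single j d) c := by
  have h : Finsupp.mapDomain (Equiv.swap i j) a = a := by
    ext k
    rw [Finsupp.mapDomain_equiv_apply, Equiv.symm_swap]
    rcases eq_or_ne k i with rfl | hi
    · rw [Equiv.swap_apply_left, ha]
    · rcases eq_or_ne k j with rfl | hj
      · rw [Equiv.swap_apply_right, ha]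
      · rw [Equiv.swap_apply_of_ne_of_ne hi hj]
  rw [rename_monomial, Finsupp.mapDomain_add, Finsupp.mapDomain_single, Equiv.swap_apply_left, h]

/-- The excess `d` at `i` is redistributed between `i` and `j`. The term `t = d - 1` is the original
monomial; in all others the larger exponent is strictly smaller than before. -/
theorem X_mul_diffQuot_monomial {i j : Fin N} (h : j ≠ i) {a : Fin N →₀ ℕ} (ha : a i = a j)
    (d : ℕ) :
    X i * diffQuot K h (monomial (a + Finsupp.single i d) 1) =
      ∑ t ∈ Finset.range d,
        monomial (a + (Finsupp.single i (t + 1) + Finsupp.single j (d - 1 - t))) 1 := by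
  have hF : rename (Equiv.swap i j) (monomial a (1 : K)) = monomial a 1 := by
    simpa using rename_swap_monomial ha 0 (1 : K)
  have hm : monomial (a + Finsupp.single i d) (1 : K) = X i ^ d * monomial a 1 := by
    rw [X_pow_eq_monomial, monomial_mul, mul_one, add_comm]
  rw [hm, diffQuot_X_pow_mul h d hF, Finset.sum_mul, Finset.mul_sum]
  refine Finset.sum_congr rfl fun t _ => ?_
  rw [← mul_assoc, ← mul_assoc, ← pow_succ', X_pow_eq_monomial, X_pow_eq_monomial, monomial_mul,
    monomial_mul, one_mul, one_mul, add_comm]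

/-- Every exponent vector is obtained from one with equal entries at `i` and `j` by increasing one
of the two. -/
theorem exists_eq_add_single (i j : Fin N) (b : Fin N →₀ ℕ) :
    ∃ (a : Fin N →₀ ℕ) (d : ℕ), a i = a j ∧
      (b = a + Finsupp.single i d ∨ b = a + Finsupp.single j d) := by
  rcases eq_or_ne i j with rfl | hij
  · exact ⟨b, 0, rfl, by simp⟩
  rcases le_total (b j) (b i) with h | h
  · refine ⟨b - Finsupp.single i (b i - b j), b i - b j, ?_, Or.inl ?_⟩
    · simp [hij]
      omega
    · rw [tsub_add_cancel_of_le]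
      simp
  · refine ⟨b - Finsupp.single j (b j - b i), b j - b i, ?_, Or.inr ?_⟩
    · simp [hij]
      omega
    · rw [tsub_add_cancel_of_le]
      simp

theorem expLE_add_single_swap {n : ℕ} {lam : n.Partition} {i j : Fin N} (hij : i ≠ j)
    {a : Fin N →₀ ℕ} (ha : a i = a j) {d : ℕ} (h : ExpLE (a + Finsupp.single i d) lam) :
    ExpLE (a + Finsupp.single j d) lam := by
  refine h.of_move hij (fun k hi hj => ?_) ?_ ?_
  · simp [hi.symm, hj.symm]
  · simp [hij, hij.symm, ha]
    omega
  · simp [hij, hij.symm, ha]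

theorem X_mul_diffQuot_mem_domSpan {n : ℕ} (lam : n.Partition) {i j : Fin N} (h : j ≠ i)
    {f : MvPolynomial (Fin N) K} (hf : f ∈ domSpan K N lam) :
    X i * diffQuot K h f ∈ domSpan K N lam := by
  suffices H : domSpan K N lam ≤
      (domSpan K N lam).comap (LinearMap.mulLeft K (X i) * diffQuot K h) from H hf
  conv_lhs => rw [domSpan, restrictSupport_eq_span]
  rw [Submodule.span_le]
  rintro _ ⟨b, hb, rfl⟩
  have key : ∀ (a : Fin N →₀ ℕ) (d : ℕ), a i = a j → ExpLE (a + Finsupp.single i d) lam →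
      X i * diffQuot K h (monomial (a + Finsupp.single i d) 1) ∈ domSpan K N lam := by
    intro a d ha hd
    rw [X_mul_diffQuot_monomial h ha]
    refine Submodule.sum_mem _ fun t ht => monomial_mem_domSpan ?_ _
    have ht := Finset.mem_range.1 ht
    refine hd.of_move h.symm (fun k hi hj => ?_) ?_ ?_
    · simp [hi.symm, hj.symm]
    · simp [h, h.symm]
      omega
    · simp [h, h.symm, ha]
      omega
  change X i * diffQuot K h (monomial b 1) ∈ domSpan K N lam
  obtain ⟨a, d, ha, rfl | rfl⟩ := exists_eq_add_single i j b
  · exact key a d ha hb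
  · rw [← rename_swap_monomial ha, diffQuot_rename_swap, mul_neg]
    exact Submodule.neg_mem _ (key a d ha (expLE_add_single_swap h ha.symm hb))

theorem coeff_X_mul_pderiv (i : Fin N) (f : MvPolynomial (Fin N) K) (b : Fin N →₀ ℕ) :
    coeff b (X i * pderiv i f) = b i * coeff b f := by
  classical
  induction f using MvPolynomial.induction_on' with
  | add f g hf hg => rw [map_add, mul_add, coeff_add, hf, hg, coeff_add, mul_add]
  | monomial a c =>
    rw [X_mul_pderiv_monomial, coeff_smul, coeff_monomial, nsmul_eq_mul]
    split_ifs with h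
    · rw [h]
    · simp

theorem xDunkl_mem_domSpan (θ : K) {n : ℕ} (lam : n.Partition) (i : Fin N)
    {f : MvPolynomial (Fin N) K} (hf : f ∈ domSpan K N lam) : xDunkl θ i f ∈ domSpan K N lam := by
  rw [xDunkl_apply]
  refine Submodule.add_mem _ ?_ (Submodule.smul_mem _ _ (Submodule.sum_mem _ fun j _ =>
    X_mul_diffQuot_mem_domSpan lam j.2 hf))
  rw [mem_domSpan_iff] at hf ⊢
  intro a ha
  rw [coeff_X_mul_pderiv] at ha
  exact hf a (right_ne_zero_of_mul ha)

theorem xDunkl_shift_pow_mem_domSpan (θ c : K) {n : ℕ} (lam : n.Partition) (i : Fin N) (m : ℕ)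
    {f : MvPolynomial (Fin N) K} (hf : f ∈ domSpan K N lam) :
    ((xDunkl θ i + c • 1) ^ m) f ∈ domSpan K N lam := by
  induction m with
  | zero => exact hf
  | succ m ih =>
    rw [pow_succ', Module.End.mul_apply, LinearMap.add_apply]
    exact Submodule.add_mem _ (xDunkl_mem_domSpan θ lam i ih) (Submodule.smul_mem _ _ ih)

/-- At an exponent `b` of maximal type, strictly redistributed monomials cannot contribute, by
`not_strict_move`. Only the unchanged monomial and its antisymmetric counterpart remain, always with
the larger exponent at `i`. -/
theorem coeff_X_mul_diffQuot {n : ℕ} {i j : Fin N} (h : j ≠ i) {b : Fin N →₀ ℕ}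
    (hb : ∑ k, b k = n) {f : MvPolynomial (Fin N) K} (hf : f ∈ domSpan K N (expPartition b hb)) :
    coeff b (X i * diffQuot K h f) =
      if b j < b i then coeff b (f - rename (Equiv.swap i j) f) else 0 := by
  classical
  have key : ∀ (a : Fin N →₀ ℕ) (d : ℕ), a i = a j →
      ExpLE (a + Finsupp.single i d) (expPartition b hb) →
      coeff b (X i * diffQuot K h (monomial (a + Finsupp.single i d) 1)) =
        if b j < b i then coeff b (monomial (a + Finsupp.single i d) (1 : K) -
          monomial (a + Finsupp.single j d) 1) else 0 := by
    intro a d ha hd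
    rw [X_mul_diffQuot_monomial h ha, coeff_sum]
    rcases d with _ | d
    · simp
    -- The last summand is the monomial itself; all the others are strict moves.
    rw [Finset.sum_range_succ, Finset.sum_eq_zero, zero_add, coeff_sub]
    · simp only [coeff_monomial, add_tsub_cancel_right, tsub_self, Finsupp.single_zero, add_zero]
      have h₂ : b j < b i → a + Finsupp.single j (d + 1) ≠ b := by
        rintro hlt rfl
        simp [h.symm, ha] at hlt
      by_cases h₁ : a + Finsupp.single i (d + 1) = b
      · have hlt : b j < b i := by
          rw [← h₁]
          simp [h.symm, ha]
        rw [if_pos h₁, if_pos hlt, if_neg (h₂ hlt), sub_zero]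
      · rw [if_neg h₁]
        split_ifs with h₃ h₄
        · exact absurd h₄ (h₂ h₃)
        · simp
        · rfl
    · intro t ht
      have ht := Finset.mem_range.1 ht
      rw [coeff_monomial, if_neg]
      rintro rfl
      refine not_strict_move hb h.symm (fun k hi hj => ?_) ?_ ?_ hd
      · simp [hi.symm, hj.symm]
      · simp [h, h.symm]
        omega
      · simp [h, h.symm, ha]
        omega
  -- Both sides are linear in `f`, so it is enough to compare them on dominated monomials.
  set φ : MvPolynomial (Fin N) K →ₗ[K] K :=
    lcoeff K b ∘ₗ LinearMap.mulLeft K (X i) ∘ₗ diffQuot K h with hφ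
  set ψ : MvPolynomial (Fin N) K →ₗ[K] K := if b j < b i then
    lcoeff K b ∘ₗ (LinearMap.id - (rename (Equiv.swap i j)).toLinearMap) else 0 with hψ
  have hψ' : ∀ g, ψ g = if b j < b i then coeff b (g - rename (Equiv.swap i j) g) else 0 := by
    intro g
    rw [hψ]
    split_ifs <;> rfl
  rw [← hψ']
  change φ f = ψ f
  rw [domSpan, restrictSupport_eq_span] at hf
  refine LinearMap.eqOn_span ?_ hf
  rintro _ ⟨c, hc, rfl⟩
  rw [hψ']
  change coeff b (X i * diffQuot K h (monomial c 1)) = if b j < b i then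
    coeff b (monomial c 1 - rename (Equiv.swap i j) (monomial c 1)) else 0
  obtain ⟨a, d, ha, rfl | rfl⟩ := exists_eq_add_single i j c
  · rw [key a d ha hc, rename_swap_monomial ha]
  · have e := key a d ha (expLE_add_single_swap h ha.symm hc)
    rw [← rename_swap_monomial ha, diffQuot_rename_swap, mul_neg, coeff_neg, e, rename_rename,
      ← Equiv.coe_trans, Equiv.swap_swap, Equiv.coe_refl, rename_id_apply, rename_swap_monomial ha]
    split_ifs
    · rw [coeff_sub, coeff_sub, neg_sub]
    · rw [neg_zero]

theorem coeff_xDunkl (θ : K) {n : ℕ} (i : Fin N) {b : Fin N →₀ ℕ}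
    (hb : ∑ k, b k = n) {f : MvPolynomial (Fin N) K} (hf : f ∈ domSpan K N (expPartition b hb)) :
    coeff b (xDunkl θ i f) = b i * coeff b f +
      θ * ∑ j, if b j < b i then coeff b (f - rename (Equiv.swap i j) f) else 0 := by
  rw [xDunkl_apply, coeff_add, coeff_smul, coeff_sum, coeff_X_mul_pderiv, smul_eq_mul,
    ← Finset.add_sum_erase _ _ (Finset.mem_univ i), if_neg (lt_irrefl _), zero_add]
  congr 2
  rw [Finset.sum_subtype (Finset.univ.erase i) (p := fun j => j ≠ i) (fun j => by simp)]
  exact Finset.sum_congr rfl fun j _ => coeff_X_mul_diffQuot j.2 hb hf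

end Triangular

/-! ### Monomial symmetric polynomials -/

section Msymm

variable {K : Type*} [Field K] {N : ℕ}

theorem filter_map_univ (a : Fin N →₀ ℕ) :
    (Finset.univ.val.map a).filter (· ≠ 0) = a.support.val.map a := by
  rw [Multiset.filter_map]
  congr 1
  have : a.support = Finset.univ.filter fun i => a i ≠ 0 := by
    ext
    simp
  rw [this]
  rfl

theorem prod_map_X (s : Multiset (Fin N)) :
    (s.map (X : Fin N → MvPolynomial (Fin N) K)).prod = monomial (Multiset.toFinsupp s) 1 := by
  induction s using Multiset.induction_on with
  | empty => simp
  | cons i s ih =>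
    rw [Multiset.map_cons, Multiset.prod_cons, ih, X, monomial_mul, mul_one,
      ← Multiset.singleton_add, map_add, Multiset.toFinsupp_singleton]

open Classical in
theorem coeff_msymm {n : ℕ} (μ : n.Partition) (a : Fin N →₀ ℕ) :
    coeff a (msymm (Fin N) K μ) = if a.support.val.map a = μ.parts then 1 else 0 := by
  have hparts : ∀ s : Sym (Fin N) n, (Nat.Partition.ofSym s).parts =
      (Multiset.toFinsupp s.1).support.val.map (Multiset.toFinsupp s.1) := fun s => by
    simp only [Nat.Partition.ofSym, Multiset.toFinsupp_support, Multiset.toFinset_val]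
    exact Multiset.map_congr (by congr) fun i _ => (Multiset.toFinsupp_apply _ _).symm
  simp only [msymm, coeff_sum, prod_map_X, coeff_monomial]
  split_ifs with h
  · have hc : Multiset.card (Finsupp.toMultiset a) = n := by
      rw [Finsupp.card_toMultiset, ← μ.parts_sum, ← h]
      rfl
    have hs : Multiset.toFinsupp (Finsupp.toMultiset a) = a := Finsupp.toMultiset_toFinsupp a
    have hμ : Nat.Partition.ofSym (Sym.mk (Finsupp.toMultiset a) hc) = μ :=
      Nat.Partition.ext ((hparts _).trans (by simp only [hs, h]))
    rw [Finset.sum_eq_single_of_mem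
      (⟨Sym.mk (Finsupp.toMultiset a) hc, hμ⟩ : {s : Sym (Fin N) n // .ofSym s = μ})
      (Finset.mem_univ _)]
    · rw [if_pos hs]
    · rintro ⟨s, hs'⟩ _ hne
      rw [if_neg]
      intro e
      exact hne (Subtype.ext (Subtype.ext (Multiset.toFinsupp_eq_iff.1 e)))
  · refine Finset.sum_eq_zero ?_
    rintro ⟨s, hs⟩ _
    rw [if_neg]
    rintro rfl
    exact h (by rw [← hparts, hs])

theorem eq_of_filter_ne_zero_eq {s t : Multiset ℕ} (h : s.filter (· ≠ 0) = t.filter (· ≠ 0))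
    (hc : s.card = t.card) : s = t := by
  have key : ∀ u : Multiset ℕ, u.count 0 + (u.filter (· ≠ 0)).card = u.card := by
    intro u
    rw [Multiset.count, Multiset.countP_eq_card_filter, ← Multiset.card_add]
    congr 1
    conv_rhs => rw [← Multiset.filter_add_not (0 = ·) u]
    congr 2
    ext x
    exact ne_comm
  ext y
  rcases eq_or_ne y 0 with rfl | hy
  · have h₁ := key s
    have h₂ := key t
    rw [h] at h₁
    omega
  · rw [← Multiset.count_filter_of_pos (p := (· ≠ 0)) hy, h,
      Multiset.count_filter_of_pos (p := (· ≠ 0)) hy]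

theorem exists_perm_of_map_univ_eq {α β : Type*} [Fintype α] {a b : α → β}
    (h : Finset.univ.val.map a = Finset.univ.val.map b) :
    ∃ e : Equiv.Perm α, ∀ i, b (e i) = a i := by
  classical
  have hc : ∀ y, Fintype.card {i // a i = y} = Fintype.card {i // b i = y} := by
    intro y
    have := congrArg (Multiset.count y) h
    rw [Multiset.count_map, Multiset.count_map] at this
    rw [Fintype.card_subtype, Fintype.card_subtype]
    simpa only [Finset.card, Finset.filter, eq_comm] using this
  exact ⟨Equiv.ofFiberEquiv fun y => Fintype.equivOfCardEq (hc y),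
    fun i => Equiv.ofFiberEquiv_map _ i⟩

theorem coeff_rename_perm (e : Equiv.Perm (Fin N)) (f : MvPolynomial (Fin N) K) (b : Fin N →₀ ℕ) :
    coeff b (rename e f) = coeff (Finsupp.equivFunOnFinite.symm (b ∘ e)) f := by
  conv_rhs => rw [← coeff_rename_mapDomain e e.injective]
  congr 1
  ext i
  rw [Finsupp.mapDomain_equiv_apply]
  simp

theorem coeff_eq_of_isSymmetric {f : MvPolynomial (Fin N) K} (hf : f.IsSymmetric)
    {a b : Fin N →₀ ℕ} (h : a.support.val.map a = b.support.val.map b) : coeff a f = coeff b f := by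
  obtain ⟨e, he⟩ := exists_perm_of_map_univ_eq (a := a) (b := b)
    (eq_of_filter_ne_zero_eq (by rw [filter_map_univ, filter_map_univ, h]) (by simp))
  conv_rhs => rw [← hf e, coeff_rename_perm]
  congr 1
  ext i
  exact (he i).symm

/-- A homogeneous symmetric polynomial is a combination of monomial symmetric polynomials, the
coefficients being coefficients of the polynomial. -/
theorem exists_eq_sum_msymm {n : ℕ} {f : MvPolynomial (Fin N) K} (hf : f.IsSymmetric)
    (hn : f.IsHomogeneous n) :
    ∃ u : n.Partition → K, f = ∑ μ, u μ • msymm (Fin N) K μ ∧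
      ∀ μ, u μ ≠ 0 → ∃ a : Fin N →₀ ℕ, a.support.val.map a = μ.parts ∧ coeff a f = u μ := by
  classical
  -- When no exponent vector in `N` variables has type `μ`, the polynomial `m_μ` vanishes and its
  -- coefficient is set to zero.
  refine ⟨fun μ => if h : ∃ a : Fin N →₀ ℕ, a.support.val.map a = μ.parts then
    coeff h.choose f else 0, ?_, fun μ hμ => ?_⟩
  · ext a
    simp only [coeff_sum, coeff_smul, coeff_msymm, smul_eq_mul]
    by_cases ha : a.degree = n
    · have hsum : (a.support.val.map a).sum = n := ha
      set ν : n.Partition := ⟨a.support.val.map a, fun {i} hi => by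
        obtain ⟨k, hk, rfl⟩ := Multiset.mem_map.1 hi
        exact Nat.pos_of_ne_zero (Finsupp.mem_support_iff.1 hk), hsum⟩ with hν
      rw [Finset.sum_eq_single_of_mem ν (Finset.mem_univ _)]
      · have h : ∃ b : Fin N →₀ ℕ, b.support.val.map b = ν.parts := ⟨a, rfl⟩
        rw [dif_pos h, if_pos rfl, mul_one]
        exact coeff_eq_of_isSymmetric hf h.choose_spec.symm
      · intro μ _ hμ
        rw [if_neg, mul_zero]
        exact fun e => hμ (Nat.Partition.ext e.symm)
    · rw [hn.coeff_eq_zero ha, Finset.sum_eq_zero]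
      intro μ _
      rw [if_neg, mul_zero]
      intro e
      apply ha
      rw [← μ.parts_sum, ← e]
      rfl
  · dsimp only at hμ ⊢
    split_ifs at hμ ⊢ with h
    · exact ⟨h.choose, h.choose_spec, rfl⟩
    · exact absurd rfl hμ

theorem map_msymm {L : Type*} [Field L] (φ : K →+* L) {n : ℕ} (μ : n.Partition) :
    MvPolynomial.map φ (msymm (Fin N) K μ) = msymm (Fin N) L μ := by
  classical
  ext a
  rw [coeff_map, coeff_msymm, coeff_msymm]
  split_ifs <;> simp

theorem msymm_isHomogeneous {n : ℕ} (μ : n.Partition) :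
    (msymm (Fin N) K μ).IsHomogeneous n := by
  classical
  intro a ha
  rw [coeff_msymm] at ha
  split_ifs at ha with h
  · rw [Pi.one_def, ← Finsupp.degree_eq_weight_one, ← μ.parts_sum, ← h]
    rfl
  · exact absurd rfl ha

end Msymm

/-! ### Symmetric functions and symmetric polynomials -/

section ToVars

variable {K : Type*} [Field K]

theorem isHomogeneous_toVars (N : ℕ) {f : SymFn K} {n : ℕ} (hf : IsHomog f n) :
    (SymFn.toVars N f).IsHomogeneous n := by
  induction hf using IsWeightedHomogeneous.induction_on with
  | zero => rw [map_zero]; exact isHomogeneous_zero _ _ _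
  | add p q _ _ hp hq => rw [map_add]; exact hp.add hq
  | monomial d r hr =>
    rw [SymFn.toVars, aeval_monomial, algebraMap_eq, ← zero_add n, ← hr]
    refine (isHomogeneous_C _ _).mul ?_
    rw [Finsupp.weight_apply]
    refine IsHomogeneous.prod _ _ _ fun k _ => ?_
    change (psum (Fin N) K k ^ d k).IsHomogeneous (d k * k)
    rw [mul_comm]
    refine IsHomogeneous.pow (IsHomogeneous.sum _ _ _ fun i _ => ?_) _
    simpa using (isHomogeneous_X K i).pow k

theorem toVars_weightedHomogeneousComponent (N n : ℕ) (f : SymFn K) :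
    SymFn.toVars N (weightedHomogeneousComponent (fun k : ℕ+ => (k : ℕ)) n f) =
      homogeneousComponent n (SymFn.toVars N f) := by
  induction f using MvPolynomial.induction_on' with
  | add f g hf hg => simp only [map_add, hf, hg]
  | monomial d r =>
    have h : IsHomog (monomial d r : SymFn K) (Finsupp.weight (fun k : ℕ+ => (k : ℕ)) d) :=
      isWeightedHomogeneous_monomial _ _ _ rfl
    rw [weightedHomogeneousComponent_of_mem h,
      homogeneousComponent_of_mem (isHomogeneous_toVars N h)]
    split_ifs <;> simp

/-- Power sums satisfy no relation in degree at most the number of variables. Applying `x_i ∂_i` to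
a relation gives `∑ x_i^{l+1} (pDer l f) = 0` for every `i`; the Vandermonde determinant of the
distinct `x_i` kills each coefficient, and induction on the degree makes all derivatives of `f`
zero. In characteristic zero `f` is then constant. -/
theorem eq_zero_of_toVars_eq_zero [CharZero K] {N n : ℕ} (hN : n ≤ N) {f : SymFn K}
    (hf : IsHomog f n) (h0 : SymFn.toVars N f = 0) : f = 0 := by
  induction n using Nat.strong_induction_on generalizing f with
  | _ n ih =>
    have hder : ∀ l : ℕ, pDer l f = 0 := by
      intro l
      rcases lt_or_ge l n with hl | hl
      · have hv := Matrix.eq_zero_of_forall_index_sum_pow_mul_eq_zero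
          (f := fun i : Fin N => (X i : MvPolynomial (Fin N) K))
          (v := fun l => SymFn.toVars N (pDer l f)) X_injective (fun i => by
            have := X_mul_pderiv_toVars i hf hN
            rw [h0, map_zero, mul_zero, Finset.sum_range] at this
            simp only [pow_succ', mul_assoc, ← Finset.mul_sum] at this
            exact (mul_eq_zero.1 this.symm).resolve_left (X_ne_zero i))
        exact ih (n - (l + 1)) (by omega) (by omega) (hf.pDer (by omega))
          (congrFun hv ⟨l, hl.trans_le hN⟩)
      · exact hf.pDer_eq_zero hl
    have hcoeff : ∀ d : ℕ+ →₀ ℕ, d ≠ 0 → coeff d f = 0 := by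
      intro d hd
      obtain ⟨k, hk⟩ := Finsupp.support_nonempty_iff.2 hd
      have hk' := Finsupp.mem_support_iff.1 hk
      have h₁ := hder (k - 1)
      rw [pDer_apply] at h₁
      have hk₁ : ((k : ℕ) - 1).succPNat = k :=
        PNat.eq (Nat.sub_add_cancel k.pos)
      rw [hk₁, smul_eq_zero] at h₁
      have h₂ := h₁.resolve_left (Nat.cast_add_one_ne_zero _)
      have h₃ := congrArg (coeff (d - Finsupp.single k 1)) h₂
      rw [coeff_pderiv, coeff_zero, tsub_add_cancel_of_le
        (Finsupp.single_le_iff.2 (Nat.one_le_iff_ne_zero.2 hk'))] at h₃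
      exact (mul_eq_zero.1 h₃).resolve_right (Nat.cast_add_one_ne_zero _)
    have hC : f = C (coeff 0 f) := by
      ext d
      classical
      rw [coeff_C]
      split_ifs with hd
      · rw [hd]
      · exact hcoeff d (Ne.symm hd)
    rw [hC, SymFn.toVars, aeval_C, algebraMap_eq] at h0
    rw [hC, C_eq_zero.1 h0, map_zero]

/-- A symmetric function is determined by its values at all finite sets of variables. -/
theorem toVars_ext [CharZero K] {f g : SymFn K}
    (h : ∀ N, SymFn.toVars N f = SymFn.toVars N g) : f = g := by
  rw [← sub_eq_zero, ← finsum_weightedHomogeneousComponent (fun k : ℕ+ => (k : ℕ)) (f - g),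
    finsum_eq_zero_of_forall_eq_zero]
  intro n
  refine eq_zero_of_toVars_eq_zero le_rfl
    (weightedHomogeneousComponent_isWeightedHomogeneous n (f - g)) ?_
  rw [toVars_weightedHomogeneousComponent, map_sub, h, sub_self, map_zero]

/-- Newton's identities, where characteristic zero allows division by `k`. -/
theorem esymm_mem_range_toVars [CharZero K] (N k : ℕ) :
    esymm (Fin N) K k ∈ (SymFn.toVars N : SymFn K →ₐ[K] _).range := by
  induction k using Nat.strong_induction_on with
  | _ k ih =>
    rcases Nat.eq_zero_or_pos k with rfl | hk
    · rw [esymm_zero]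
      exact Subalgebra.one_mem _
    have h := mul_esymm_eq_sum (Fin N) K k
    have hmem : (k : MvPolynomial (Fin N) K) * esymm (Fin N) K k ∈
        (SymFn.toVars N : SymFn K →ₐ[K] _).range := by
      rw [h]
      refine Subalgebra.mul_mem _ (Subalgebra.pow_mem _ (Subalgebra.neg_mem _
        (Subalgebra.one_mem _)) _) (Subalgebra.sum_mem _ fun a ha => ?_)
      rw [Finset.mem_filter, Finset.HasAntidiagonal.mem_antidiagonal] at ha
      refine Subalgebra.mul_mem _ (Subalgebra.mul_mem _ (Subalgebra.pow_mem _
        (Subalgebra.neg_mem _ (Subalgebra.one_mem _)) _) (ih _ ha.2)) ?_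
      exact ⟨X ⟨a.2, by omega⟩, toVars_X _⟩
    have h' := Subalgebra.smul_mem _ hmem ((k : K)⁻¹)
    rwa [smul_eq_C_mul, ← map_natCast (C : K →+* MvPolynomial (Fin N) K), ← mul_assoc, ← map_mul,
      inv_mul_cancel₀ (Nat.cast_ne_zero.2 hk.ne'), map_one, one_mul] at h'

theorem exists_toVars_eq [CharZero K] (N : ℕ) {F : MvPolynomial (Fin N) K} (hF : F.IsSymmetric) :
    ∃ f : SymFn K, SymFn.toVars N f = F := by
  obtain ⟨g, hg⟩ := esymmAlgHom_fin_surjective K (le_refl N) ⟨F, hF⟩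
  have hg' := congrArg Subtype.val hg
  rw [esymmAlgHom_apply] at hg'
  change _ = F at hg'
  choose e he using esymm_mem_range_toVars (K := K) N
  refine ⟨aeval (fun i : Fin N => e (i + 1)) g, ?_⟩
  rw [← hg', ← AlgHom.comp_apply, comp_aeval]
  congr 2
  ext i : 1
  exact he (i + 1)

theorem exists_isHomog_toVars_eq [CharZero K] (N : ℕ) {n : ℕ} {F : MvPolynomial (Fin N) K}
    (hF : F.IsSymmetric) (hn : F.IsHomogeneous n) :
    ∃ f : SymFn K, IsHomog f n ∧ SymFn.toVars N f = F := by
  obtain ⟨f, rfl⟩ := exists_toVars_eq N hF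
  refine ⟨_, weightedHomogeneousComponent_isWeightedHomogeneous n f, ?_⟩
  rw [toVars_weightedHomogeneousComponent, homogeneousComponent_of_mem hn, if_pos rfl]

theorem killCompl_toVars {M N : ℕ} (h : M ≤ N) (f : SymFn K) :
    killCompl (Fin.castLE_injective h) (SymFn.toVars N f) = SymFn.toVars M f := by
  suffices H : (killCompl (Fin.castLE_injective h)).comp (SymFn.toVars N) =
      (SymFn.toVars M : SymFn K →ₐ[K] _) from congrArg (fun φ => φ f) H
  apply algHom_ext
  intro k
  rw [AlgHom.comp_apply, toVars_X, toVars_X, psum, psum, map_sum]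
  symm
  refine Fintype.sum_of_injective _ (Fin.castLE_injective h) _ _ (fun i hi => ?_) fun i => ?_
  · rw [map_pow, killCompl, aeval_X, dif_neg hi, zero_pow k.ne_zero]
  · rw [map_pow, ← rename_X, killCompl_rename_app]

theorem killCompl_msymm {M N : ℕ} (h : M ≤ N) {n : ℕ} (μ : n.Partition) :
    killCompl (Fin.castLE_injective h) (msymm (Fin N) K μ) = msymm (Fin M) K μ := by
  classical
  ext a
  rw [coeff_killCompl, coeff_msymm, coeff_msymm]
  congr 2
  rw [Finsupp.mapDomain_support_of_injective (Fin.castLE_injective h),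
    Finset.image_val_of_injOn (Fin.castLE_injective h).injOn, Multiset.map_map]
  exact Multiset.map_congr rfl fun i _ => Finsupp.mapDomain_apply (Fin.castLE_injective h) _ _

/-- A lift from `n` variables works for every number of variables: for fewer, set variables to zero;
for more, a lift from there agrees with it in `n` variables, hence equals it because degree `n` is
faithfully seen there. -/
theorem exists_isMonomialSymm [CharZero K] {n : ℕ} (μ : n.Partition) :
    ∃ g : SymFn K, IsHomog g n ∧ IsMonomialSymm μ g := by
  have hex : ∀ N, ∃ g : SymFn K, IsHomog g n ∧ SymFn.toVars N g = msymm (Fin N) K μ := fun N =>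
    exists_isHomog_toVars_eq N (msymm_isSymmetric _ _ μ) (msymm_isHomogeneous μ)
  obtain ⟨g, hg, hgn⟩ := hex n
  refine ⟨g, hg, fun M => ?_⟩
  rcases le_total M n with h | h
  · rw [← killCompl_toVars h, hgn, killCompl_msymm]
  · obtain ⟨g', hg', hgM⟩ := hex M
    have : g - g' = 0 := by
      refine eq_zero_of_toVars_eq_zero le_rfl (hg.sub hg') ?_
      rw [map_sub, hgn, ← killCompl_toVars h g', hgM, killCompl_msymm, sub_self]
    rw [sub_eq_zero.1 this, hgM]

/-- The monomial symmetric function `m_μ`. -/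
def monoSymm (K : Type*) [Field K] [CharZero K] {n : ℕ} (μ : n.Partition) : SymFn K :=
  (exists_isMonomialSymm μ).choose

theorem isHomog_monoSymm [CharZero K] {n : ℕ} (μ : n.Partition) : IsHomog (monoSymm K μ) n :=
  (exists_isMonomialSymm μ).choose_spec.1

theorem toVars_monoSymm [CharZero K] {n : ℕ} (μ : n.Partition) (N : ℕ) :
    SymFn.toVars N (monoSymm K μ) = msymm (Fin N) K μ :=
  (exists_isMonomialSymm μ).choose_spec.2 N

theorem IsMonomialSymm.eq_monoSymm [CharZero K] {n : ℕ} {μ : n.Partition} {g : SymFn K}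
    (h : IsMonomialSymm μ g) : g = monoSymm K μ :=
  toVars_ext fun N => (h N).trans (toVars_monoSymm μ N).symm

theorem map_toVars {L : Type*} [Field L] (φ : K →+* L) (N : ℕ) (f : SymFn K) :
    MvPolynomial.map φ (SymFn.toVars N f) = SymFn.toVars N (MvPolynomial.map φ f) := by
  induction f using MvPolynomial.induction_on with
  | C c => simp [SymFn.toVars, algebraMap_eq]
  | add f g hf hg => simp only [map_add, hf, hg]
  | mul_X f k hf =>
    rw [map_mul, map_mul, hf, map_mul, map_mul, map_X, toVars_X, toVars_X]
    simp [psum]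

theorem map_monoSymm [CharZero K] {L : Type*} [Field L] [CharZero L] (φ : K →+* L) {n : ℕ}
    (μ : n.Partition) : MvPolynomial.map φ (monoSymm K μ) = monoSymm L μ :=
  IsMonomialSymm.eq_monoSymm fun N => by rw [← map_toVars, toVars_monoSymm, map_msymm]

/-- A partition of `n` has at most `n` parts, so padding with zeros fits it into `n` variables. -/
theorem exists_exponent {n : ℕ} (ν : n.Partition) :
    ∃ a : Fin n →₀ ℕ, a.support.val.map a = ν.parts := by
  set l := ν.parts.toList with hl
  have hpos : ∀ x ∈ l, x ≠ 0 := fun x hx => (ν.parts_pos (Multiset.mem_toList.1 hx)).ne'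
  have hlen : l.length ≤ n := by
    have h : ν.parts.card • 1 ≤ ν.parts.sum :=
      Multiset.card_nsmul_le_sum fun x hx => ν.parts_pos hx
    rwa [smul_eq_mul, mul_one, ν.parts_sum, ← Multiset.length_toList] at h
  refine ⟨Finsupp.equivFunOnFinite.symm fun i : Fin n => l.getD i 0, ?_⟩
  rw [← filter_map_univ, Finsupp.coe_equivFunOnFinite_symm, Fin.univ_val_map]
  have : List.ofFn (fun i : Fin n => l.getD i 0) = l ++ List.replicate (n - l.length) 0 := by
    apply List.ext_getElem
    · simp
      omega
    · intro i h₁ h₂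
      rw [List.getElem_ofFn, List.getElem_append]
      split_ifs with h
      · simp [h]
      · simp [not_lt.1 h]
  rw [this, ← Multiset.coe_add, Multiset.filter_add, Multiset.filter_eq_self.2,
    Multiset.filter_eq_nil.2, add_zero, hl, Multiset.coe_toList]
  · intro x hx
    simpa using (List.eq_of_mem_replicate (Multiset.mem_coe.1 hx))
  · exact fun x hx => hpos x (Multiset.mem_coe.1 hx)

theorem linearIndependent_monoSymm [CharZero K] (n : ℕ) :
    LinearIndependent K fun μ : n.Partition => monoSymm K μ := by
  classical
  rw [Fintype.linearIndependent_iff]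
  intro u hu ν
  obtain ⟨a, ha⟩ := exists_exponent ν
  have h := congrArg (coeff a) (congrArg (SymFn.toVars n) hu)
  simp only [map_sum, map_smul, toVars_monoSymm, map_zero, coeff_sum, coeff_smul, coeff_msymm,
    coeff_zero] at h
  rw [Finset.sum_eq_single_of_mem ν (Finset.mem_univ _)] at h
  · simpa [ha] using h
  · intro μ _ hμ
    rw [if_neg, smul_zero]
    exact fun e => hμ (Nat.Partition.ext (e.symm.trans ha))

/-- A homogeneous symmetric function is a combination of monomial symmetric functions. -/
theorem exists_eq_sum_monoSymm [CharZero K] {n : ℕ} {f : SymFn K} (hf : IsHomog f n) :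
    ∃ u : n.Partition → K, f = ∑ μ, u μ • monoSymm K μ ∧ ∀ μ, u μ ≠ 0 →
      ∃ a : Fin n →₀ ℕ, a.support.val.map a = μ.parts ∧ coeff a (SymFn.toVars n f) = u μ := by
  obtain ⟨u, hu, hu'⟩ := exists_eq_sum_msymm (toVars_isSymmetric f) (isHomogeneous_toVars n hf)
  refine ⟨u, ?_, hu'⟩
  rw [← sub_eq_zero]
  refine eq_zero_of_toVars_eq_zero le_rfl (hf.sub (IsWeightedHomogeneous.sum _ _ _ fun μ _ =>
    (isHomog_monoSymm μ).smul (u μ))) ?_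
  simp only [map_sub, map_sum, map_smul, toVars_monoSymm]
  rw [hu, sub_self]

end ToVars

/-! ### Nondegeneracy of the deformed Hall form -/

section Gram

/-- The inverse of `θ` is not a root of any rational polynomial that has no positive real roots. -/
def IsGeneric {K : Type*} [Field K] [CharZero K] (θ : K) : Prop :=
  ∀ p : Polynomial ℚ, (∀ t : ℝ, 0 < t → Polynomial.aeval t p ≠ 0) → Polynomial.aeval θ⁻¹ p ≠ 0

/-- A root `1/θ` would make `θ` algebraic, since the polynomial is nonzero (look at `t = 1`); for
real `θ` the root would be a positive real number. -/
theorem isGeneric_of_transcendental_or_pos {K : Type*} [Field K] [Algebra ℂ K] [CharZero K] {θ : K}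
    (hθ : Transcendental ℂ θ ∨ ∃ t : ℝ, 0 < t ∧ θ = algebraMap ℂ K (t : ℂ)) : IsGeneric θ := by
  intro p hp h0
  rcases hθ with hθ | ⟨t, ht, rfl⟩
  · apply hθ
    have hq : IsAlgebraic ℚ θ⁻¹ := ⟨p, fun e => hp 1 one_pos (by rw [e, map_zero]), h0⟩
    have hq' : IsAlgebraic ℂ θ⁻¹ := hq.tower_top ℂ
    simpa using hq'.inv
  · apply hp t⁻¹ (inv_pos.2 ht)
    set φ : ℝ →+* K := (algebraMap ℂ K).comp Complex.ofRealHom with hφ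
    have e : ((algebraMap ℂ K) (t : ℂ))⁻¹ = φ t⁻¹ := by
      rw [map_inv₀]
      rfl
    rw [e, Polynomial.aeval_def, ← Subsingleton.elim (φ.comp (algebraMap ℚ ℝ)) (algebraMap ℚ K),
      ← Polynomial.hom_eval₂] at h0
    exact (map_eq_zero φ).1 h0

variable {K : Type*} [Field K] [CharZero K]

theorem IsGeneric.ne_zero {θ : K} (hθ : IsGeneric θ) : θ ≠ 0 := by
  have := hθ Polynomial.X fun t ht => by simpa using ht.ne'
  simpa using this

/-- `hallWeight` as a polynomial in `1 / θ`. -/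
def hallWeightPoly (a : ℕ+ →₀ ℕ) : Polynomial ℚ :=
  a.prod fun (k : ℕ+) (r : ℕ) =>
    (((k : ℕ) : Polynomial ℚ) * Polynomial.X) ^ r * (r.factorial : Polynomial ℚ)

theorem aeval_hallWeightPoly (θ : K) (a : ℕ+ →₀ ℕ) :
    Polynomial.aeval θ⁻¹ (hallWeightPoly a) = hallWeight θ a := by
  rw [hallWeightPoly, hallWeight, Finsupp.prod, Finsupp.prod, map_prod]
  refine Finset.prod_congr rfl fun k _ => ?_
  simp [div_eq_mul_inv]

theorem hallWeight_pos {t : ℝ} (ht : 0 < t) (a : ℕ+ →₀ ℕ) : 0 < hallWeight t a := by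
  refine Finset.prod_pos fun k _ => ?_
  have := k.pos
  positivity

theorem hall_self_pos {t : ℝ} (ht : 0 < t) {f : SymFn ℝ} (hf : f ≠ 0) : 0 < hall t f f := by
  rw [hall_eq_sum_of_subset t f f subset_rfl]
  refine Finset.sum_pos (fun a ha => ?_) (support_nonempty.2 hf)
  exact mul_pos (mul_self_pos.2 (mem_support_iff.1 ha)) (hallWeight_pos ht a)

/-- The products `⟨m_μ, m_ν⟩` as polynomials in `1 / θ`. -/
def gramPoly {n : ℕ} (μ ν : n.Partition) : Polynomial ℚ :=
  ∑ a ∈ (monoSymm ℚ μ).support, Polynomial.C ((monoSymm ℚ μ).coeff a * (monoSymm ℚ ν).coeff a) *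
    hallWeightPoly a

theorem aeval_gramPoly (θ : K) {n : ℕ} (μ ν : n.Partition) :
    Polynomial.aeval θ⁻¹ (gramPoly μ ν) = hall θ (monoSymm K μ) (monoSymm K ν) := by
  rw [← map_monoSymm (algebraMap ℚ K) μ, ← map_monoSymm (algebraMap ℚ K) ν,
    hall_eq_sum_of_subset θ _ _ (support_map_subset _ _), gramPoly, map_sum]
  refine Finset.sum_congr rfl fun a _ => ?_
  rw [map_mul, aeval_hallWeightPoly, Polynomial.aeval_C, coeff_map, coeff_map, map_mul]

theorem det_gram_eq_aeval (θ : K) {n : ℕ} {ι : Type*} [Fintype ι] [DecidableEq ι]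
    (μ : ι → n.Partition) :
    (Matrix.of fun i j => hall θ (monoSymm K (μ i)) (monoSymm K (μ j))).det =
      Polynomial.aeval θ⁻¹ (Matrix.of fun i j => gramPoly (μ i) (μ j)).det := by
  rw [AlgHom.map_det]
  congr 1
  ext i j
  exact (aeval_gramPoly θ (μ i) (μ j)).symm

/-- The `m_μ` have rational coefficients in the power sums, so the determinant is a rational
polynomial in `1/θ`. At a positive real parameter it is the Gram determinant of independent vectors
for a positive definite form, hence nonzero, and genericity transfers this to `θ`. -/
theorem det_gram_ne_zero {θ : K} (hθ : IsGeneric θ) {n : ℕ} {ι : Type*} [Fintype ι] [DecidableEq ι]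
    {μ : ι → n.Partition} (hμ : Function.Injective μ) :
    (Matrix.of fun i j => hall θ (monoSymm K (μ i)) (monoSymm K (μ j))).det ≠ 0 := by
  rw [det_gram_eq_aeval]
  apply hθ
  intro t ht h0
  -- The polynomial is evaluated at the inverse parameter, so the value at `t` belongs to the form
  -- with parameter `t⁻¹`.
  have hk := det_gram_eq_aeval t⁻¹ μ
  rw [inv_inv] at hk
  rw [← hk, ← Matrix.exists_mulVec_eq_zero_iff] at h0
  obtain ⟨v, hv, hG⟩ := h0
  have hf : ∑ i, v i • monoSymm ℝ (μ i) ≠ 0 := fun h => hv <| funext <|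
    Fintype.linearIndependent_iff.1 ((linearIndependent_monoSymm n).comp μ hμ) v h
  refine (hall_self_pos (inv_pos.2 ht) hf).ne' ?_
  rw [← hallForm_apply]
  simp only [map_sum, map_smul, LinearMap.sum_apply, LinearMap.smul_apply, hallForm_apply,
    smul_eq_mul]
  refine Finset.sum_eq_zero fun i _ => ?_
  have := congrFun hG i
  simp only [Matrix.mulVec, dotProduct, Matrix.of_apply, Pi.zero_apply] at this
  refine mul_eq_zero_of_right _ ?_
  rw [← this]
  refine Finset.sum_congr rfl fun j _ => ?_
  rw [mul_comm, hall_comm]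

end Gram

/-! ### The eigenvalue -/

section Eigenvalue

variable {K : Type*} [Field K]

theorem aeval_hsymm {σ : Type*} [Fintype σ] [DecidableEq σ] (y : σ → K) (m : ℕ) :
    aeval y (hsymm σ K m) = ∑ s : Sym σ m, (s.1.map y).prod := by
  rw [hsymm, map_sum]
  refine Finset.sum_congr rfl fun s _ => ?_
  rw [map_multiset_prod, Multiset.map_map]
  congr 2
  ext i
  simp

theorem aeval_hsymm_equiv {σ τ : Type*} [Fintype σ] [DecidableEq σ] [Fintype τ] [DecidableEq τ]
    (e : σ ≃ τ) (y : τ → K) (m : ℕ) :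
    aeval (y ∘ e) (hsymm σ K m) = aeval y (hsymm τ K m) := by
  rw [← rename_hsymm σ K m e, aeval_rename]

/-- Multisets of size `m + 1` are sorted by whether they contain the extra element. -/
theorem aeval_hsymm_option {σ : Type*} [Fintype σ] [DecidableEq σ] (y : Option σ → K) (m : ℕ) :
    aeval y (hsymm (Option σ) K (m + 1)) = y none * aeval y (hsymm (Option σ) K m) +
      aeval (y ∘ some) (hsymm σ K (m + 1)) := by
  rw [aeval_hsymm, aeval_hsymm, aeval_hsymm, ← Equiv.sum_comp symOptionSuccEquiv.symm,
    Fintype.sum_sum_type, Finset.mul_sum]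
  congr 1
  · refine Finset.sum_congr rfl fun s _ => ?_
    change (((none ::ₛ s : Sym (Option σ) (m + 1)) : Multiset (Option σ)).map y).prod = _
    rw [Sym.coe_cons, Multiset.map_cons, Multiset.prod_cons]
    rfl
  · refine Finset.sum_congr rfl fun s _ => ?_
    change (((s.map Function.Embedding.some : Sym (Option σ) (m + 1)) :
      Multiset (Option σ)).map y).prod = _
    rw [Sym.coe_map, Multiset.map_map]
    rfl

/-- The complete homogeneous symmetric polynomial `h_m` in `(x_i)_{i ∈ s}`, zero for `m < 0`. -/
def hOn {N : ℕ} (x : Fin N → K) (s : Finset (Fin N)) (m : ℤ) : K :=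
  if m < 0 then 0 else aeval (fun i : s => x i) (hsymm s K m.toNat)

theorem hSub_eq_sum {N : ℕ} (x : Fin N → K) (r : ℕ) (m : ℤ) :
    hSub r m x = ∑ s ∈ Finset.powersetCard r Finset.univ, hOn x s m := by
  rw [hSub]
  split_ifs with h
  · exact (Finset.sum_eq_zero fun s _ => if_pos h).symm
  · exact Finset.sum_congr rfl fun s _ => (if_neg h).symm

theorem hOn_zero {N : ℕ} (x : Fin N → K) (s : Finset (Fin N)) : hOn x s 0 = 1 := by
  simp [hOn]

theorem hOn_of_neg {N : ℕ} (x : Fin N → K) (s : Finset (Fin N)) {m : ℤ} (hm : m < 0) :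
    hOn x s m = 0 :=
  if_pos hm

theorem hOn_empty {N : ℕ} (x : Fin N → K) {m : ℤ} (hm : 0 < m) : hOn x ∅ m = 0 := by
  obtain ⟨m, rfl⟩ : ∃ k : ℕ, m = k + 1 := ⟨(m - 1).toNat, by omega⟩
  rw [hOn, if_neg (by omega), aeval_hsymm]
  have : IsEmpty (Sym (∅ : Finset (Fin N)) ((m : ℤ) + 1).toNat) := by
    rw [show ((m : ℤ) + 1).toNat = m + 1 by omega]
    infer_instance
  exact Finset.sum_of_isEmpty _

/-- The convention for negative degree makes the recursion valid for every integer `m`, so no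
boundary cases arise when it is used. -/
theorem hOn_insert {N : ℕ} (x : Fin N → K) {s : Finset (Fin N)} {k : Fin N} (hk : k ∉ s) (m : ℤ) :
    hOn x (insert k s) m = x k * hOn x (insert k s) (m - 1) + hOn x s m := by
  rcases lt_trichotomy m 0 with hm | rfl | hm
  · rw [hOn_of_neg x _ hm, hOn_of_neg x _ hm, hOn_of_neg x _ (by omega), mul_zero, add_zero]
  · rw [hOn_zero, hOn_zero, hOn_of_neg x _ (by omega), mul_zero, zero_add]
  · obtain ⟨m, rfl⟩ : ∃ k : ℕ, m = k + 1 := ⟨(m - 1).toNat, by omega⟩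
    set y : Option s → K := fun o => o.elim (x k) fun i => x i with hy
    have he : (fun i : (insert k s : Finset (Fin N)) => x i) =
        y ∘ Finset.subtypeInsertEquivOption hk := by
      ext ⟨i, hi⟩
      simp only [Function.comp_apply, Finset.subtypeInsertEquivOption, Equiv.coe_fn_mk, hy]
      split_ifs with h
      · simp [h]
      · simp
    rw [hOn, hOn, hOn, if_neg (by omega), if_neg (by omega), if_neg (by omega),
      show ((m : ℤ) + 1).toNat = m + 1 by omega, show ((m : ℤ) + 1 - 1).toNat = m by omega, he,
      aeval_hsymm_equiv, aeval_hsymm_equiv, aeval_hsymm_option]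
    rfl

/-- Sorting the subsets of an upper set by their least element. -/
theorem sum_powerset_eq_sum_min {N : ℕ} {M : Type*} [AddCommMonoid M] {A : Finset (Fin N)}
    (hA : ∀ j ∈ A, Finset.Ioi j ⊆ A) (F : Finset (Fin N) → M) :
    ∑ T ∈ A.powerset, F T = F ∅ + ∑ j ∈ A, ∑ T ∈ (Finset.Ioi j).powerset, F (insert j T) := by
  classical
  have hmem : ∀ j : Fin N, ∀ T ∈ (Finset.Ioi j).powerset, ∀ i ∈ T, j < i := fun j T hT i hi =>
    Finset.mem_Ioi.1 (Finset.mem_powerset.1 hT hi)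
  have hinj : ∀ j : Fin N, Set.InjOn (insert j)
      ((Finset.Ioi j).powerset : Set (Finset (Fin N))) := by
    intro j T hT T' hT' h
    rw [← Finset.erase_insert fun hj => (hmem j T hT j hj).false, h,
      Finset.erase_insert fun hj => (hmem j T' hT' j hj).false]
  have hU : A.powerset.erase ∅ =
      A.biUnion fun j => (Finset.Ioi j).powerset.image (insert j) := by
    ext T
    simp only [Finset.mem_erase, Finset.mem_powerset, Finset.mem_biUnion, Finset.mem_image]
    constructor
    · rintro ⟨hne, hT⟩
      have hne := Finset.nonempty_iff_ne_empty.2 hne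
      refine ⟨T.min' hne, hT (T.min'_mem hne), T.erase (T.min' hne), fun i hi => ?_,
        Finset.insert_erase (T.min'_mem hne)⟩
      exact Finset.mem_Ioi.2 (Finset.min'_lt_of_mem_erase_min' T hne hi)
    · rintro ⟨j, hj, T, hT, rfl⟩
      exact ⟨Finset.insert_ne_empty _ _, Finset.insert_subset hj (hT.trans (hA j hj))⟩
  rw [← Finset.add_sum_erase _ _ (Finset.empty_mem_powerset A), hU, Finset.sum_biUnion]
  · congr 1
    exact Finset.sum_congr rfl fun j _ => Finset.sum_image (hinj j)
  · intro j _ j' _ hne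
    rw [Function.onFun, Finset.disjoint_left]
    intro S hS hS'
    obtain ⟨T, hT, rfl⟩ := Finset.mem_image.1 hS
    obtain ⟨T', hT', h⟩ := Finset.mem_image.1 hS'
    have h₁ : j' ∈ insert j T := h ▸ Finset.mem_insert_self _ _
    have h₂ : j ∈ insert j' T' := h ▸ Finset.mem_insert_self _ _
    rcases Finset.mem_insert.1 h₁ with h₁ | h₁
    · exact hne h₁.symm
    rcases Finset.mem_insert.1 h₂ with h₂ | h₂
    · exact hne h₂
    exact lt_asymm (hmem j T hT _ h₁) (hmem j' T' hT' _ h₂)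

theorem eigMatrix_mulVec (θ : K) {N : ℕ} (lam : Fin N → ℕ) (c : Fin N → K) (k : Fin N) :
    (eigMatrix θ lam).mulVec c k = ell θ lam k * c k - θ * ∑ j ∈ Finset.Ioi k, c j := by
  have h : ∀ j, eigMatrix θ lam k j * c j =
      (if k = j then ell θ lam k * c k else 0) + if k < j then -θ * c j else 0 := by
    intro j
    rw [eigMatrix, Matrix.of_apply]
    rcases lt_trichotomy k j with h | rfl | h
    · simp [h, h.ne]
    · simp
    · simp [h.ne', h.not_gt]
  simp only [Matrix.mulVec, dotProduct, h, Finset.sum_add_distrib]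
  rw [Finset.sum_ite_eq, if_pos (Finset.mem_univ _), ← Finset.sum_filter, ← Finset.mul_sum,
    neg_mul, ← sub_eq_add_neg]
  congr 3
  ext
  simp

/-- A path of `m` steps from `k` visits an increasing set `insert k T` of indices: each strict step
costs `-θ`, and the remaining `m - |T|` steps stay in place, giving a complete homogeneous
polynomial in the visited `ℓ`'s. -/
theorem eigMatrix_pow_mulVec_one (θ : K) {N : ℕ} (lam : Fin N → ℕ) (m : ℕ) (k : Fin N) :
    (eigMatrix θ lam ^ m).mulVec (fun _ => 1) k =
      ∑ T ∈ (Finset.Ioi k).powerset,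
        (-θ) ^ T.card * hOn (ell θ lam) (insert k T) ((m : ℤ) - T.card) := by
  induction m generalizing k with
  | zero =>
    rw [pow_zero, Matrix.one_mulVec, Finset.sum_eq_single_of_mem ∅ (Finset.empty_mem_powerset _)]
    · simp [hOn_zero]
    · intro T _ hT
      have := Finset.card_pos.2 (Finset.nonempty_iff_ne_empty.2 hT)
      rw [hOn_of_neg _ _ (by push_cast; omega), mul_zero]
  | succ m ih =>
    rw [pow_succ', ← Matrix.mulVec_mulVec, eigMatrix_mulVec]
    simp only [ih]
    have hk : ∀ T ∈ (Finset.Ioi k).powerset, k ∉ T := fun T hT hk =>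
      (Finset.mem_Ioi.1 (Finset.mem_powerset.1 hT hk)).false
    have hsplit : ∀ T ∈ (Finset.Ioi k).powerset,
        (-θ) ^ T.card * hOn (ell θ lam) (insert k T) (((m + 1 : ℕ) : ℤ) - T.card) =
          ell θ lam k * ((-θ) ^ T.card * hOn (ell θ lam) (insert k T) ((m : ℤ) - T.card)) +
            (-θ) ^ T.card * hOn (ell θ lam) T ((m : ℤ) + 1 - T.card) := by
      intro T hT
      rw [hOn_insert _ (hk T hT), show (((m + 1 : ℕ) : ℤ) - T.card - 1) = (m : ℤ) - T.card by
        push_cast; ring]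
      push_cast
      ring
    rw [Finset.sum_congr rfl hsplit, Finset.sum_add_distrib, ← Finset.mul_sum, sub_eq_add_neg]
    congr 1
    -- The least element `j` of `T` is the first index reached after `k`; the empty `T` drops out
    -- because `h_{m+1}` in no variables is zero.
    rw [sum_powerset_eq_sum_min fun j hj => Finset.Ioi_subset_Ioi (Finset.mem_Ioi.1 hj).le,
      Finset.card_empty, hOn_empty _ (by push_cast; omega), mul_zero, zero_add, ← neg_mul,
      Finset.mul_sum]
    refine Finset.sum_congr rfl fun j _ => ?_
    rw [Finset.mul_sum]
    refine Finset.sum_congr rfl fun T hT => ?_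
    have hj : j ∉ T := fun hj => (Finset.mem_Ioi.1 (Finset.mem_powerset.1 hT hj)).false
    rw [Finset.card_insert_of_notMem hj, pow_succ', mul_assoc]
    congr 3
    push_cast
    ring

theorem eig_eq_dotProduct (θ : K) {N : ℕ} (lam : Fin N → ℕ) (m : ℕ) :
    eig θ lam m = (fun _ => 1) ⬝ᵥ ((eigMatrix θ lam ^ m).mulVec fun _ => 1) := by
  classical
  set F : Finset (Fin N) → K := fun S => if S = ∅ then 0 else
    (-θ) ^ (S.card - 1) * hOn (ell θ lam) S ((m : ℤ) + 1 - S.card) with hF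
  have h₁ : ∑ S ∈ (Finset.univ : Finset (Fin N)).powerset, F S =
      (fun _ => 1) ⬝ᵥ ((eigMatrix θ lam ^ m).mulVec fun _ => 1) := by
    rw [sum_powerset_eq_sum_min fun j _ => Finset.subset_univ _]
    simp only [dotProduct, one_mul, eigMatrix_pow_mulVec_one]
    rw [show F ∅ = 0 from if_pos rfl, zero_add]
    refine Finset.sum_congr rfl fun j _ => Finset.sum_congr rfl fun T hT => ?_
    have hj : j ∉ T := fun hj => (Finset.mem_Ioi.1 (Finset.mem_powerset.1 hT hj)).false
    simp only [hF]
    rw [if_neg (Finset.insert_ne_empty _ _), Finset.card_insert_of_notMem hj,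
      add_tsub_cancel_right]
    congr 2
    push_cast
    ring
  rw [← h₁, Finset.sum_powerset, Finset.card_univ, Fintype.card_fin, eig, Finset.sum_range_succ',
    Finset.powersetCard_zero, Finset.sum_singleton, Finset.range_eq_Ico,
    Finset.sum_Ico_add' (fun r => ∑ S ∈ Finset.powersetCard r Finset.univ, F S) 0 N 1]
  have hF0 : F ∅ = 0 := if_pos rfl
  rw [hF0, add_zero]
  refine Finset.sum_congr (by ext; simp) fun r hr => ?_
  rw [hSub_eq_sum, Finset.mul_sum]
  refine Finset.sum_congr rfl fun S hS => ?_
  have hc := (Finset.mem_powersetCard.1 hS).2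
  have hr' := (Finset.mem_Ico.1 hr).1
  rw [hF, ← hc]
  refine (if_neg ?_).symm
  rintro rfl
  simp at hc
  omega

end Eigenvalue

/-! ### The leading coefficient -/

section Leading

variable {K : Type*} [Field K] {N : ℕ}

/-- At the exponent `λ ∘ σ`, exchanging `i` and `j` replaces `c (σ i)` by `c (σ j)`. The terms with
a smaller part at `j` therefore sum `c (σ i) - c (σ j)` over larger indices `σ j`; their number `N -
1 - σ i` completes `λ` to `ℓ`, and the rest is the off-diagonal part of `U`. -/
theorem coeff_xDunkl_perm (θ : K) {lam : Fin N → ℕ} (hlam : Antitone lam) (i : Fin N)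
    {f : MvPolynomial (Fin N) K} (hf : f ∈ domSpan K N (toPartition lam)) {c : Fin N → K}
    (hc : ∀ σ : Equiv.Perm (Fin N),
      coeff (Finsupp.equivFunOnFinite.symm (lam ∘ σ)) f = c (σ i)) (σ : Equiv.Perm (Fin N)) :
    coeff (Finsupp.equivFunOnFinite.symm (lam ∘ σ)) (xDunkl θ i f) =
      (eigMatrix θ lam).mulVec c (σ i) := by
  set b : Fin N →₀ ℕ := Finsupp.equivFunOnFinite.symm (lam ∘ σ) with hbdef
  have hbl : ∀ k, b k = lam (σ k) := fun k => rfl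
  have hb : ∑ k, b k = ∑ k, lam k := Equiv.sum_comp σ lam
  have hp : expPartition b hb = toPartition lam := by
    ext1
    rw [expPartition_parts]
    change _ = (Finset.univ.val.map lam).filter (· ≠ 0)
    have : Finset.univ.val.map (b : Fin N → ℕ) = Finset.univ.val.map lam := by
      conv_rhs => rw [← Multiset.map_univ_val_equiv σ, Multiset.map_map]
      rfl
    rw [this]
  -- For equal parts, `σ j > σ i` does not give a strictly smaller part, but then the entries of `c`
  -- agree and the extra terms are zero.
  have htie : ∀ j, lam j = lam (σ i) → c j = c (σ i) := by
    intro j hj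
    have h := hc (Equiv.swap (σ i) j * σ)
    have hl : lam ∘ (Equiv.swap (σ i) j * σ : Equiv.Perm (Fin N)) = lam ∘ σ := by
      ext k
      simp only [Function.comp_apply, Equiv.Perm.mul_apply]
      rcases eq_or_ne (σ k) (σ i) with h₁ | h₁
      · rw [h₁, Equiv.swap_apply_left, hj]
      · rcases eq_or_ne (σ k) j with h₂ | h₂
        · rw [h₂, Equiv.swap_apply_right, hj]
        · rw [Equiv.swap_apply_of_ne_of_ne h₁ h₂]
    rw [hl, hc σ, Equiv.Perm.mul_apply, Equiv.swap_apply_left] at h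
    exact h.symm
  have hterm : ∀ j, (if b j < b i then coeff b (f - rename (Equiv.swap i j) f) else 0) =
      if σ i < σ j then c (σ i) - c (σ j) else 0 := by
    intro j
    have hr : coeff b (rename (Equiv.swap i j) f) = c (σ j) := by
      rw [coeff_rename_perm]
      have h := hc (σ * Equiv.swap i j)
      rw [Equiv.Perm.mul_apply, Equiv.swap_apply_left] at h
      exact h
    rw [coeff_sub, hr, hbdef, hc σ, ← hbdef, hbl, hbl]
    rcases lt_or_ge (σ i) (σ j) with h | h
    · rw [if_pos h]
      split_ifs with h'
      · rfl
      · rw [htie (σ j) (le_antisymm (hlam h.le) (not_lt.1 h')), sub_self]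
    · rw [if_neg (hlam h).not_gt, if_neg h.not_gt]
  rw [coeff_xDunkl θ i hb (hp ▸ hf), Finset.sum_congr rfl fun j _ => hterm j, eigMatrix_mulVec,
    Equiv.sum_comp σ (fun j => if σ i < j then c (σ i) - c j else 0), ← Finset.sum_filter,
    Finset.sum_sub_distrib, Finset.sum_const, nsmul_eq_mul, hbdef, hc σ, ← hbdef, hbl, ell]
  have hfilter : Finset.univ.filter (fun j => σ i < j) = Finset.Ioi (σ i) := by
    ext
    simp
  have hcard : ((Finset.Ioi (σ i)).card : K) = (N : K) - (((σ i : Fin N) : ℕ) + 1) := by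
    have h := (σ i).2
    rw [Fin.card_Ioi, Nat.sub_sub, add_comm 1, Nat.cast_sub h]
    push_cast
    ring
  rw [hfilter, hcard]
  ring

theorem coeff_xDunkl_pow_perm (θ : K) {lam : Fin N → ℕ} (hlam : Antitone lam) (i : Fin N)
    {f : MvPolynomial (Fin N) K} (hf : f ∈ domSpan K N (toPartition lam))
    (hc : ∀ σ : Equiv.Perm (Fin N), coeff (Finsupp.equivFunOnFinite.symm (lam ∘ σ)) f = 1)
    (m : ℕ) (σ : Equiv.Perm (Fin N)) :
    coeff (Finsupp.equivFunOnFinite.symm (lam ∘ σ)) ((xDunkl θ i ^ m) f) =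
      (eigMatrix θ lam ^ m).mulVec (fun _ => 1) (σ i) := by
  induction m generalizing σ with
  | zero => simpa using hc σ
  | succ m ih =>
    have hm : (xDunkl θ i ^ m) f ∈ domSpan K N (toPartition lam) := by
      simpa using xDunkl_shift_pow_mem_domSpan θ 0 (toPartition lam) i m hf
    rw [pow_succ', Module.End.mul_apply, coeff_xDunkl_perm θ hlam i hm ih, pow_succ',
      Matrix.mulVec_mulVec]

/-- For the identity rearrangement, the `i`-th summand contributes the `i`-th entry of `U^m 1`. -/
theorem coeff_hpOp (θ : K) {lam : Fin N → ℕ} (hlam : Antitone lam)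
    {f : MvPolynomial (Fin N) K} (hf : f ∈ domSpan K N (toPartition lam))
    (hc : ∀ σ : Equiv.Perm (Fin N), coeff (Finsupp.equivFunOnFinite.symm (lam ∘ σ)) f = 1)
    (m : ℕ) : coeff (Finsupp.equivFunOnFinite.symm lam) (hpOp N θ m f) = eig θ lam m := by
  rw [eig_eq_dotProduct, hpOp, LinearMap.sum_apply, coeff_sum]
  simp only [dotProduct, one_mul]
  exact Finset.sum_congr rfl fun i _ => coeff_xDunkl_pow_perm θ hlam i hf hc m 1

theorem msymm_mem_domSpan {n : ℕ} {μ ν : n.Partition} (h : DomLE μ ν) :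
    msymm (Fin N) K μ ∈ domSpan K N ν := by
  classical
  rw [mem_domSpan_iff]
  intro a ha
  rw [coeff_msymm] at ha
  split_ifs at ha with hμ
  · have hs : ∑ i, a i = n := by
      rw [← μ.parts_sum, ← hμ, ← filter_map_univ, sum_filter_ne_zero]
      rfl
    rw [expLE_iff hs]
    have : expPartition a hs = μ := by
      ext1
      rw [expPartition_parts, filter_map_univ, hμ]
    rwa [this]
  · exact absurd rfl ha

theorem IsJackP.toVars_mem_domSpan {θ : K} {n : ℕ} {ν : n.Partition} {f : SymFn K}
    (hf : IsJackP θ ν f) : SymFn.toVars N f ∈ domSpan K N ν := by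
  obtain ⟨u, -, hu, huN⟩ := hf.triangular
  rw [huN]
  refine Submodule.sum_mem _ fun μ _ => ?_
  by_cases h0 : u μ = 0
  · rw [h0, zero_smul]
    exact Submodule.zero_mem _
  · exact Submodule.smul_mem _ _ (msymm_mem_domSpan (hu μ h0))

theorem IsJackP.coeff_toVars {θ : K} {n : ℕ} {ν : n.Partition} {f : SymFn K} (hf : IsJackP θ ν f)
    {a : Fin N →₀ ℕ} (ha : a.support.val.map a = ν.parts) : coeff a (SymFn.toVars N f) = 1 := by
  classical
  obtain ⟨u, hu1, -, huN⟩ := hf.triangular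
  simp only [huN, coeff_sum, coeff_smul, coeff_msymm]
  rw [Finset.sum_eq_single_of_mem ν (Finset.mem_univ _)]
  · rw [if_pos ha, hu1, one_smul]
  · intro μ _ hμ
    rw [if_neg, smul_zero]
    exact fun e => hμ (Nat.Partition.ext (e.symm.trans ha))

theorem IsJackP.coeff_toVars_perm {θ : K} {lam : Fin N → ℕ} {f : SymFn K}
    (hf : IsJackP θ (toPartition lam) f) (σ : Equiv.Perm (Fin N)) :
    coeff (Finsupp.equivFunOnFinite.symm (lam ∘ σ)) (SymFn.toVars N f) = 1 := by
  have h := toVars_isSymmetric (N := N) f σ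
  rw [← hf.coeff_toVars (N := N) (a := Finsupp.equivFunOnFinite.symm lam)]
  · conv_rhs => rw [← h, coeff_rename_perm]
    rfl
  · rw [← filter_map_univ]
    rfl

end Leading

/-! ### Jack symmetric functions -/

section Jack

variable {K : Type*} [Field K] [CharZero K] {n : ℕ}

/-- The span of the monomial symmetric functions `m_μ` with `μ ≺ ν`. -/
def lowerSpan (K : Type*) [Field K] [CharZero K] {n : ℕ} (ν : n.Partition) :
    Submodule K (SymFn K) :=
  Submodule.span K (Set.range fun i : {μ : n.Partition // DomLE μ ν ∧ μ ≠ ν} => monoSymm K i.1)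

theorem monoSymm_mem_lowerSpan {μ ν : n.Partition} (h : DomLE μ ν) (hne : μ ≠ ν) :
    monoSymm K μ ∈ lowerSpan K ν :=
  Submodule.subset_span ⟨⟨μ, h, hne⟩, rfl⟩

theorem hall_eq_zero_of_mem_lowerSpan {θ : K} {ν : n.Partition} {f g : SymFn K}
    (hf : ∀ μ, DomLE μ ν → μ ≠ ν → hall θ f (monoSymm K μ) = 0) (hg : g ∈ lowerSpan K ν) :
    hall θ f g = 0 := by
  have : lowerSpan K ν ≤ LinearMap.ker (hallForm θ f) := by
    rw [lowerSpan, Submodule.span_le]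
    rintro _ ⟨μ, rfl⟩
    exact hf μ μ.2.1 μ.2.2
  exact this hg

/-- Nondegeneracy of the Hall form on `lowerSpan`, from its Gram determinant. -/
theorem eq_zero_of_mem_lowerSpan {θ : K} (hθ : IsGeneric θ) {ν : n.Partition} {f : SymFn K}
    (hf : f ∈ lowerSpan K ν) (h : ∀ μ, DomLE μ ν → μ ≠ ν → hall θ f (monoSymm K μ) = 0) :
    f = 0 := by
  classical
  obtain ⟨u, rfl⟩ := (Submodule.mem_span_range_iff_exists_fun K).1 hf
  have hdet := det_gram_ne_zero hθ (μ := fun i : {μ : n.Partition // DomLE μ ν ∧ μ ≠ ν} => i.1)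
    Subtype.val_injective
  have hu : u = 0 := by
    refine Matrix.eq_zero_of_vecMul_eq_zero hdet (funext fun j => ?_)
    have hj := h j j.2.1 j.2.2
    rw [← hallForm_apply, map_sum, LinearMap.sum_apply] at hj
    simpa [Matrix.vecMul, dotProduct] using hj
  simp [hu]

/-- Orthogonal projection to `lowerSpan`, computed with the inverse Gram matrix. -/
theorem exists_mem_lowerSpan {θ : K} (hθ : IsGeneric θ) (ν : n.Partition) (f : SymFn K) :
    ∃ g ∈ lowerSpan K ν, ∀ μ, DomLE μ ν → μ ≠ ν →
      hall θ g (monoSymm K μ) = hall θ f (monoSymm K μ) := by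
  classical
  have hdet := det_gram_ne_zero hθ (μ := fun i : {μ : n.Partition // DomLE μ ν ∧ μ ≠ ν} => i.1)
    Subtype.val_injective
  set G : Matrix {μ : n.Partition // DomLE μ ν ∧ μ ≠ ν} {μ : n.Partition // DomLE μ ν ∧ μ ≠ ν} K :=
    Matrix.of fun i j => hall θ (monoSymm K i.1) (monoSymm K j.1) with hG
  set b : {μ : n.Partition // DomLE μ ν ∧ μ ≠ ν} → K := fun j => hall θ f (monoSymm K j.1) with hb
  set u := Matrix.vecMul b G⁻¹ with hu
  have hGu : Matrix.vecMul u G = b := by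
    rw [hu, Matrix.vecMul_vecMul, Matrix.nonsing_inv_mul _ (isUnit_iff_ne_zero.2 hdet),
      Matrix.vecMul_one]
  refine ⟨∑ i, u i • monoSymm K i.1, Submodule.sum_mem _ fun i _ =>
    Submodule.smul_mem _ _ (monoSymm_mem_lowerSpan i.2.1 i.2.2), fun μ h hne => ?_⟩
  have := congrFun hGu ⟨μ, h, hne⟩
  rw [← hallForm_apply, map_sum, LinearMap.sum_apply]
  simpa [Matrix.vecMul, dotProduct, hG, hb] using this

theorem exists_coeffs_of_mem_lowerSpan {ν : n.Partition} {f : SymFn K} (hf : f ∈ lowerSpan K ν) :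
    ∃ u : n.Partition → K, (∀ μ, u μ ≠ 0 → DomLE μ ν ∧ μ ≠ ν) ∧ f = ∑ μ, u μ • monoSymm K μ := by
  classical
  induction hf using Submodule.span_induction with
  | mem f hf =>
    obtain ⟨μ, rfl⟩ := hf
    refine ⟨Pi.single μ.1 1, fun ρ hρ => ?_, ?_⟩
    · obtain rfl : ρ = μ.1 := by
        by_contra h
        exact hρ (Pi.single_eq_of_ne h _)
      exact μ.2
    · rw [Finset.sum_eq_single_of_mem μ.1 (Finset.mem_univ _)]
      · rw [Pi.single_eq_same, one_smul]
      · intro ρ _ hρ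
        rw [Pi.single_eq_of_ne hρ, zero_smul]
  | zero => exact ⟨0, fun μ h => absurd rfl h, by simp⟩
  | add f g _ _ hf hg =>
    obtain ⟨u, hu, rfl⟩ := hf
    obtain ⟨v, hv, rfl⟩ := hg
    refine ⟨u + v, fun μ h => ?_, ?_⟩
    · by_cases h0 : u μ = 0
      · exact hv μ fun h1 => h (by simp [h0, h1])
      · exact hu μ h0
    · simp only [Pi.add_apply, add_smul, Finset.sum_add_distrib]
  | smul c f _ hf =>
    obtain ⟨u, hu, rfl⟩ := hf
    refine ⟨c • u, fun μ h => hu μ fun h0 => h (by simp [h0]), ?_⟩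
    simp only [Pi.smul_apply, smul_assoc, Finset.smul_sum]

/-- Jack symmetric functions in terms of `lowerSpan`. -/
theorem isJackP_iff {θ : K} {ν : n.Partition} {f : SymFn K} :
    IsJackP θ ν f ↔ f - monoSymm K ν ∈ lowerSpan K ν ∧
      ∀ μ, DomLE μ ν → μ ≠ ν → hall θ f (monoSymm K μ) = 0 := by
  classical
  constructor
  · rintro ⟨⟨u, hu1, hu, huN⟩, horth⟩
    refine ⟨?_, fun μ h hne => horth μ h hne _ (toVars_monoSymm μ)⟩
    have hf : f = ∑ μ, u μ • monoSymm K μ := toVars_ext fun N => by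
      simp only [huN, map_sum, map_smul, toVars_monoSymm]
    rw [hf, ← Finset.add_sum_erase _ _ (Finset.mem_univ ν), hu1, one_smul, add_sub_cancel_left]
    refine Submodule.sum_mem _ fun μ hμ => ?_
    by_cases h0 : u μ = 0
    · rw [h0, zero_smul]
      exact Submodule.zero_mem _
    · exact Submodule.smul_mem _ _ (monoSymm_mem_lowerSpan (hu μ h0) (Finset.ne_of_mem_erase hμ))
  · rintro ⟨hlow, horth⟩
    refine ⟨?_, fun μ h hne g hg => hg.eq_monoSymm ▸ horth μ h hne⟩
    obtain ⟨u, hu, he⟩ := exists_coeffs_of_mem_lowerSpan hlow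
    have hν : u ν = 0 := by
      by_contra h
      exact (hu ν h).2 rfl
    -- The expansion of `f - m_ν` has coefficient zero at `ν`; adding `m_ν` back makes it one.
    refine ⟨Function.update u ν 1, Function.update_self _ _ _, fun μ hμ => ?_, fun N => ?_⟩
    · rcases eq_or_ne μ ν with rfl | hne
      · exact DomLE.refl μ
      · rw [Function.update_of_ne hne] at hμ
        exact (hu μ hμ).1
    · rw [← sub_add_cancel f (monoSymm K ν), he, map_add, toVars_monoSymm, map_sum,
        ← Finset.add_sum_erase _ _ (Finset.mem_univ ν), hν, zero_smul, map_zero, zero_add,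
        ← Finset.add_sum_erase _ (fun μ => Function.update u ν 1 μ • msymm (Fin N) K μ)
          (Finset.mem_univ ν), Function.update_self, one_smul, add_comm]
      congr 1
      refine Finset.sum_congr rfl fun μ hμ => ?_
      rw [Function.update_of_ne (Finset.ne_of_mem_erase hμ), map_smul, toVars_monoSymm]

/-- One Gram–Schmidt step: `m_ν` minus its projection. Two solutions differ by an element of
`lowerSpan` orthogonal to `lowerSpan`. -/
theorem existsUnique_isJackP {θ : K} (hθ : IsGeneric θ) (ν : n.Partition) :
    ∃! f : SymFn K, IsJackP θ ν f := by
  obtain ⟨g, hg, horth⟩ := exists_mem_lowerSpan hθ ν (monoSymm K ν)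
  refine ⟨monoSymm K ν - g, isJackP_iff.2 ⟨?_, fun μ h hne => ?_⟩, fun f hf => ?_⟩
  · simpa using Submodule.neg_mem _ hg
  · rw [← hallForm_apply, map_sub, LinearMap.sub_apply, hallForm_apply, hallForm_apply,
      horth μ h hne, sub_self]
  · obtain ⟨hf, hf'⟩ := isJackP_iff.1 hf
    rw [← sub_eq_zero]
    refine eq_zero_of_mem_lowerSpan hθ (ν := ν) ?_ fun μ h hne => ?_
    · rw [sub_sub_eq_add_sub, add_sub_right_comm]
      exact Submodule.add_mem _ hf hg
    · rw [← hallForm_apply, map_sub, map_sub, LinearMap.sub_apply, LinearMap.sub_apply]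
      simp only [hallForm_apply, horth μ h hne, hf' μ h hne, sub_self]

/-- The operators `hpSym` are triangular for the dominance order. -/
theorem exists_hpSym_monoSymm_eq (θ c : K) (m : ℕ) (μ : n.Partition) :
    ∃ u : n.Partition → K, hpSym θ c n m (monoSymm K μ) = ∑ ρ, u ρ • monoSymm K ρ ∧
      ∀ ρ, u ρ ≠ 0 → DomLE ρ μ := by
  obtain ⟨u, hu, hu'⟩ :=
    exists_eq_sum_monoSymm (isHomog_hpSym θ c n m (isHomog_monoSymm (K := K) μ))
  refine ⟨u, hu, fun ρ hρ => ?_⟩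
  obtain ⟨a, ha, hau⟩ := hu' ρ hρ
  -- Dominance is tested in `n` variables, where every partition of `n` is visible; the scalar shift
  -- `θ (c - n)` does not disturb it.
  have hmem : SymFn.toVars n (hpSym θ c n m (monoSymm K μ)) ∈ domSpan K n μ := by
    rw [toVars_hpSym θ c n m (isHomog_monoSymm μ), toVars_monoSymm]
    exact Submodule.sum_mem _ fun i _ => xDunkl_shift_pow_mem_domSpan θ _ μ i m
      (xDunkl_mem_domSpan θ μ i (msymm_mem_domSpan (DomLE.refl μ)))
  have hE := mem_domSpan_iff.1 hmem a (by rwa [hau])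
  have : expPartition a hE.1 = ρ := by
    ext1
    rw [expPartition_parts, filter_map_univ, ha]
  rw [← this]
  exact (expLE_iff hE.1).1 hE

theorem hpSym_monoSymm_mem_lowerSpan (θ c : K) (m : ℕ) {μ ν : n.Partition} (h : DomLE μ ν)
    (hne : μ ≠ ν) : hpSym θ c n m (monoSymm K μ) ∈ lowerSpan K ν := by
  obtain ⟨u, hu, hu'⟩ := exists_hpSym_monoSymm_eq θ c m μ
  rw [hu]
  refine Submodule.sum_mem _ fun ρ _ => ?_
  by_cases h0 : u ρ = 0
  · rw [h0, zero_smul]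
    exact Submodule.zero_mem _
  · refine Submodule.smul_mem _ _ (monoSymm_mem_lowerSpan ((hu' ρ h0).trans h) ?_)
    rintro rfl
    exact hne (h.antisymm (hu' _ h0))

/-- Jack symmetric functions are eigenfunctions of `hpSym`. -/
theorem IsJackP.exists_hpSym_eq_smul {θ : K} (hθ : IsGeneric θ) (c : K) (m : ℕ) {ν : n.Partition}
    {f : SymFn K} (hf : IsJackP θ ν f) : ∃ e : K, hpSym θ c n m f = e • f := by
  classical
  obtain ⟨hlow, horth⟩ := isJackP_iff.1 hf
  obtain ⟨u, hu, hu'⟩ := exists_hpSym_monoSymm_eq θ c m ν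
  refine ⟨u ν, sub_eq_zero.1 (eq_zero_of_mem_lowerSpan hθ (ν := ν) ?_ fun μ h hne => ?_)⟩
  · have h₁ : hpSym θ c n m (f - monoSymm K ν) ∈ lowerSpan K ν := by
      have : lowerSpan K ν ≤ (lowerSpan K ν).comap (hpSym θ c n m) := by
        conv_lhs => rw [lowerSpan]
        rw [Submodule.span_le]
        rintro _ ⟨μ, rfl⟩
        exact hpSym_monoSymm_mem_lowerSpan θ c m μ.2.1 μ.2.2
      exact this hlow
    have h₂ : hpSym θ c n m (monoSymm K ν) - u ν • monoSymm K ν ∈ lowerSpan K ν := by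
      rw [hu, ← Finset.add_sum_erase _ _ (Finset.mem_univ ν), add_sub_cancel_left]
      refine Submodule.sum_mem _ fun ρ hρ => ?_
      by_cases h0 : u ρ = 0
      · rw [h0, zero_smul]
        exact Submodule.zero_mem _
      · exact Submodule.smul_mem _ _
          (monoSymm_mem_lowerSpan (hu' ρ h0) (Finset.ne_of_mem_erase hρ))
    have h₃ := Submodule.sub_mem _ (Submodule.add_mem _ h₁ h₂)
      (Submodule.smul_mem _ (u ν) hlow)
    convert h₃ using 1
    rw [map_sub, smul_sub]
    abel
  -- Self-adjointness moves the operator onto `m_μ`, whose image stays in `lowerSpan` and is thus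
  -- orthogonal to `f`.
  · rw [← hallForm_apply, map_sub, map_smul, LinearMap.sub_apply, LinearMap.smul_apply,
      hallForm_apply, hallForm_apply, horth μ h hne, smul_zero, sub_zero,
      isHallAdjoint_hpSym hθ.ne_zero]
    exact hall_eq_zero_of_mem_lowerSpan horth (hpSym_monoSymm_mem_lowerSpan θ c m h hne)

theorem IsJackP.isHomog {θ : K} {ν : n.Partition} {f : SymFn K} (hf : IsJackP θ ν f) :
    IsHomog f n := by
  obtain ⟨u, -, he⟩ := exists_coeffs_of_mem_lowerSpan (isJackP_iff.1 hf).1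
  rw [← sub_add_cancel f (monoSymm K ν), he]
  exact (IsWeightedHomogeneous.sum _ _ _ fun μ _ => (isHomog_monoSymm μ).smul (u μ)).add
    (isHomog_monoSymm ν)

end Jack

/-! ### Eigenvalue equation and nonvanishing of the normalization -/

section Main

variable {K : Type*} [Field K] [CharZero K] {N : ℕ}

/-- The abstract eigenvalue is identified by the coefficient at `x^λ`, which is one in `P_λ`. -/
theorem IsJackP.hpOp_toVars {θ : K} (hθ : IsGeneric θ) {lam : Fin N → ℕ} (hlam : Antitone lam)
    {f : SymFn K} (hf : IsJackP θ (toPartition lam) f) (m : ℕ) :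
    hpOp N θ (m + 1) (SymFn.toVars N f) = eig θ lam (m + 1) • SymFn.toVars N f := by
  obtain ⟨e, he⟩ := hf.exists_hpSym_eq_smul hθ (N : K) m
  have h₁ : hpOp N θ (m + 1) (SymFn.toVars N f) = e • SymFn.toVars N f := by
    rw [← toVars_hpSym_self θ _ m hf.isHomog, he, map_smul]
  have h₂ := coeff_hpOp θ hlam hf.toVars_mem_domSpan hf.coeff_toVars_perm (m + 1)
  have h₃ : coeff (Finsupp.equivFunOnFinite.symm lam) (SymFn.toVars N f) = 1 :=
    hf.coeff_toVars_perm 1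
  rw [h₁, coeff_smul, h₃, smul_eq_mul, mul_one] at h₂
  rw [h₁, h₂]

/-- Each factor is linear in `1/θ` with nonnegative slope and positive constant term, so it has no
positive root and genericity applies. -/
theorem jackFactor_ne_zero {θ : K} (hθ : IsGeneric θ) (lam : Fin N → ℕ) :
    jackFactor θ lam ≠ 0 := by
  refine Finset.prod_ne_zero_iff.2 fun i _ => Finset.prod_ne_zero_iff.2 fun j hj => ?_
  have hj := Finset.mem_range.1 hj
  set l := (Finset.univ.filter fun k : Fin N => i < k ∧ j < lam k).card
  have h := hθ (Polynomial.C ((lam i - j - 1 : ℕ) : ℚ) * Polynomial.X +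
    Polynomial.C ((l : ℚ) + 1)) fun t ht => by
      simp only [map_add, map_mul, Polynomial.aeval_X, map_natCast, map_one]
      positivity
  simp only [map_add, map_mul, Polynomial.aeval_X, map_natCast, map_one] at h
  rw [Nat.sub_sub, Nat.cast_sub hj] at h
  convert h using 1
  push_cast
  rw [div_eq_mul_inv]
  ring

end Main

end HeckmanPolychronakos

end

open HeckmanPolychronakos in
theorem theorem3p1 {K : Type*} [Field K] [Algebra ℂ K] (θ : K)
    (hθ : Transcendental ℂ θ ∨ ∃ t : ℝ, 0 < t ∧ θ = algebraMap ℂ K (t : ℂ))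
    (N : ℕ) (hN : 1 ≤ N) (lam : Fin N → ℕ) (hlam : Antitone lam) :
    (∃! P : SymFn K, IsJackP θ (toPartition lam) P) ∧
    jackJ θ lam ≠ 0 ∧
    ∀ m : ℕ, 1 ≤ m →
      hpOp N θ m (jackJ θ lam) = eig θ lam m • jackJ θ lam ∧
      eig θ lam m = (fun _ => 1) ⬝ᵥ ((eigMatrix θ lam ^ m).mulVec fun _ => 1) := by
  have : CharZero K := charZero_of_injective_algebraMap (algebraMap ℂ K).injective
  have hg : IsGeneric θ := isGeneric_of_transcendental_or_pos hθ
  have hex := existsUnique_isJackP hg (toPartition lam)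
  have hP : IsJackP θ (toPartition lam) (jackP θ (toPartition lam)) :=
    Classical.epsilon_spec hex.exists
  refine ⟨hex, smul_ne_zero (jackFactor_ne_zero hg lam) fun h0 => ?_, fun m hm => ⟨?_, ?_⟩⟩
  · have h1 := hP.coeff_toVars_perm 1
    rw [h0, MvPolynomial.coeff_zero] at h1
    exact zero_ne_one h1
  -- One factor `x_i D_i` is spent on reaching the initial vector of the Lax matrix, hence `m ≥ 1`.
  · obtain ⟨m, rfl⟩ := Nat.exists_eq_add_of_le' hm
    rw [jackJ, map_smul, hP.hpOp_toVars hg hlam, smul_comm]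
  · exact eig_eq_dotProduct θ lam m
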